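/- There is an absolute constant $C>0$ with the following property. Let $\mathbb H$ be a real separable Hilbert space, and let $\xi,\eta$ be Gaussian random elements of $\mathbb H$, defined on a common probability space, with mean zero and covariance operators $\Sigma_\xi,\Sigma_\eta$, where $\Sigma_\xi\neq0$. Then for every $a\in\mathbb H$ $$\sup_{x>0}\bigl|\mathbb P(\|\xi-a\|\le x)-\mathbb P(\|\eta\|\le x)\bigr|\;\le\; C\,\bigl\{\varkappa(\Sigma_\xi)+\varkappa(\Sigma_\eta)\bigr\}\Bigl(\operatorname{tr}(\Sigma_\xi)\,\bigl\|\Sigma_\xi^{-1/2}\Sigma_\eta\Sigma_\xi^{-1/2}-I\bigr\|+\|a\|^2\Bigr).$$ Here, for a covariance operator $\Sigma$ with eigenvalues $\lambda_1\ge\lambda_2\ge\dots\ge0$ (counted with multiplicity, and continued by zeros if there are only finitely many positive ones), $\Lambda_k=\bigl(\sum_{j\ge k}\lambda_j^2\bigr)^{1/2}$ for $k=1,2$, and $$\varkappa(\Sigma)=\begin{cases}\Lambda_1^{-1}, & 3\lambda_1^2\le\Lambda_1^2,\\ (\lambda_1\Lambda_2)^{-1/2}, & 3\lambda_1^2>\Lambda_1^2,\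 3\lambda_2^2\le\Lambda_2^2,\\ (\lambda_1\lambda_2)^{-1/2}, & 3\lambda_1^2>\Lambda_1^2,\ 3\lambda_2^2>\Lambda_2^2,\end{cases}$$ with values in $(0,\infty]$ (so $\varkappa(\Sigma)=\infty$ if $\lambda_2=0$); $\operatorname{tr}(\Sigma)=\sum_j\lambda_j$. The operator $\Sigma_\xi^{-1/2}$ is the (in general unbounded) inverse of the positive square root $\Sigma_\xi^{1/2}$, with domain the range of $\Sigma_\xi^{1/2}$; if $\Sigma_\xi$ is not injective, it is the inverse of the restriction of $\Sigma_\xi^{1/2}$ to $(\ker\Sigma_\xi)^\perp$. The norm $\|\Sigma_\xi^{-1/2}\Sigma_\eta\Sigma_\xi^{-1/2}-I\|$ is the supremum of $\|\Sigma_\xi^{-1/2}\Sigma_\eta\Sigma_\xi^{-1/2}x-x\|$ over the unit vectors $x$ in the domain of $\Sigma_\xi^{-1/2}$; it is $+\infty$ if this supremum is infinite or if the range of $\Sigma_\eta$ is not contained in the domain of $\Sigma_\xi^{-1/2}$. In products of elements of $[0,\infty]$ the convention $0\cdot\infty=0$ is used. -/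

import Mathlib

open MeasureTheory ProbabilityTheory
open scoped ENNReal NNReal

noncomputable section

namespace GaussianComparison

section SquareRoot

variable {H : Type*} [NormedAddCommGroup H] [InnerProductSpace ℝ H] [CompleteSpace H]

/-- The polynomials of the iteration `Y ↦ (X + Y ^ 2) / 2` started at `0`; evaluated at `1 - T`
they converge to `1 - T ^ (1/2)`. They are only used to prove that square roots exist. -/
def sqrtPoly : ℕ → Polynomial ℝ≥0
  | 0 => 0
  | n + 1 => Polynomial.C (1 / 2) * (Polynomial.X + sqrtPoly n ^ 2)

/-- The increments of `sqrtPoly`. -/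
def sqrtIncr : ℕ → Polynomial ℝ≥0
  | 0 => Polynomial.C (1 / 2) * Polynomial.X
  | n + 1 => Polynomial.C (1 / 2) * (sqrtIncr n * (sqrtPoly (n + 1) + sqrtPoly n))

theorem sqrtPoly_succ (n : ℕ) : sqrtPoly (n + 1) = sqrtPoly n + sqrtIncr n := by
  induction n with
  | zero => simp [sqrtPoly, sqrtIncr]
  | succ n ih =>
    rw [show sqrtPoly (n + 1 + 1) = Polynomial.C (1 / 2) * (Polynomial.X + sqrtPoly (n + 1) ^ 2)
      from rfl, show sqrtIncr (n + 1) =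
      Polynomial.C (1 / 2) * (sqrtIncr n * (sqrtPoly (n + 1) + sqrtPoly n)) from rfl]
    have h1 : sqrtPoly (n + 1) = Polynomial.C (1 / 2) * (Polynomial.X + sqrtPoly n ^ 2) := rfl
    calc Polynomial.C (1 / 2) * (Polynomial.X + sqrtPoly (n + 1) ^ 2)
        = Polynomial.C (1 / 2) * (Polynomial.X + sqrtPoly n ^ 2)
          + Polynomial.C (1 / 2) * (sqrtIncr n * (sqrtPoly (n + 1) + sqrtPoly n)) := by
          rw [ih]; ring
      _ = _ := by rw [← h1]

theorem sqrtPoly_eval_one_le (n : ℕ) : (sqrtPoly n).eval 1 ≤ 1 := by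
  induction n with
  | zero => simp [sqrtPoly]
  | succ n ih =>
    simp only [sqrtPoly, Polynomial.eval_mul, Polynomial.eval_C, Polynomial.eval_add,
      Polynomial.eval_X, Polynomial.eval_pow]
    have h2 : (sqrtPoly n).eval 1 ^ 2 ≤ 1 := pow_le_one₀ zero_le ih
    calc (1 / 2 : ℝ≥0) * (1 + (sqrtPoly n).eval 1 ^ 2) ≤ 1 / 2 * (1 + 1) := by gcongr
      _ = 1 := by norm_num

theorem norm_aeval_le {H : Type*} [NormedAddCommGroup H] [InnerProductSpace ℝ H] [Nontrivial H] (A : H →L[ℝ] H) (hA : ‖A‖ ≤ 1) (p : Polynomial ℝ≥0) :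
    ‖Polynomial.aeval A (p.map (algebraMap ℝ≥0 ℝ))‖ ≤ (p.eval 1 : ℝ≥0) := by
  rw [Polynomial.aeval_eq_sum_range' (n := p.natDegree + 1)
    (lt_of_le_of_lt Polynomial.natDegree_map_le (Nat.lt_succ_self _)),
    Polynomial.eval_eq_sum_range]
  push_cast
  refine (norm_sum_le _ _).trans (Finset.sum_le_sum fun i _ => ?_)
  rw [norm_smul, Polynomial.coeff_map, one_pow, mul_one]
  have h1 : ‖A ^ i‖ ≤ 1 := (norm_pow_le A i).trans (pow_le_one₀ (norm_nonneg _) hA)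
  have h2 : ‖(algebraMap ℝ≥0 ℝ) (p.coeff i)‖ = (p.coeff i : ℝ) := by
    simp [NNReal.algebraMap_eq_coe]
  rw [h2]
  exact mul_le_of_le_one_right (p.coeff i).2 h1

theorem isSelfAdjoint_smul (r : ℝ) (X : H →L[ℝ] H) (hX : IsSelfAdjoint X) :
    IsSelfAdjoint (r • X) := by
  rw [ContinuousLinearMap.isSelfAdjoint_iff_isSymmetric] at hX ⊢
  intro x y
  have h := hX x y
  simp only [ContinuousLinearMap.coe_coe] at h
  simp [real_inner_smul_left, real_inner_smul_right, h]

/-- Every positive operator on a Hilbert space has a positive square root. -/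
theorem exists_sqrt (T : H →L[ℝ] H) (hT : T.IsPositive) :
    ∃ S : H →L[ℝ] H, S.IsPositive ∧ S ∘L S = T := by
  rcases eq_or_ne T 0 with rfl | hT0
  · exact ⟨0, ContinuousLinearMap.isPositive_zero, by simp⟩
  have hnt : Nontrivial H := by
    by_contra h
    rw [not_nontrivial_iff_subsingleton] at h
    exact hT0 (Subsingleton.elim _ _)
  have hc : 0 < ‖T‖ := norm_pos_iff.2 hT0
  set B : H →L[ℝ] H := ‖T‖⁻¹ • T with hB
  have hBpos : B.IsPositive := by
    rw [ContinuousLinearMap.isPositive_iff'] at hT ⊢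
    refine ⟨isSelfAdjoint_smul _ _ hT.1, fun x => ?_⟩
    have := hT.2 x
    simp only [hB, smul_apply, real_inner_smul_left]
    positivity
  have hBnorm : ‖B‖ = 1 := by
    rw [hB, norm_smul, norm_inv, norm_norm, inv_mul_cancel₀ hc.ne']
  rw [ContinuousLinearMap.isPositive_iff'] at hBpos
  obtain ⟨hBsa, hBnn⟩ := hBpos
  have hBsym : ∀ x y, inner ℝ (B x) y = inner ℝ x (B y) := fun x y =>
    (ContinuousLinearMap.isSelfAdjoint_iff_isSymmetric.1 hBsa) x y
  have hBle : ∀ x, ‖B x‖ ^ 2 ≤ inner ℝ (B x) x := by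
    intro x
    have h1 := hBnn (x - B x)
    have h2 : inner ℝ (B (B x)) (B x) ≤ ‖B x‖ ^ 2 := by
      refine (real_inner_le_norm _ _).trans ?_
      have := B.le_opNorm (B x)
      rw [hBnorm, one_mul] at this
      nlinarith [norm_nonneg (B x)]
    have h3 : inner ℝ (B (B x)) x = ‖B x‖ ^ 2 := by
      rw [hBsym, real_inner_self_eq_norm_sq]
    rw [map_sub, inner_sub_left, inner_sub_right, inner_sub_right, h3,
      real_inner_self_eq_norm_sq] at h1
    linarith
  set A : H →L[ℝ] H := 1 - B with hA
  have hAnorm : ‖A‖ ≤ 1 := by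
    refine ContinuousLinearMap.opNorm_le_bound _ zero_le_one fun x => ?_
    rw [one_mul, ← sq_le_sq₀ (norm_nonneg _) (norm_nonneg _)]
    have h1 : A x = x - B x := by simp [hA]
    have h2 := hBle x
    rw [h1, norm_sub_sq_real, real_inner_comm]
    nlinarith [sq_nonneg ‖B x‖]
  have hAsa : IsSelfAdjoint A := (IsSelfAdjoint.one _).sub hBsa
  let Y : ℕ → H →L[ℝ] H := fun n =>
    Polynomial.aeval A ((sqrtPoly n).map (algebraMap ℝ≥0 ℝ))
  have hYs : ∀ n, Y (n + 1) = (1 / 2 : ℝ) • (A + Y n ^ 2) := by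
    intro n
    have h2 : (algebraMap ℝ≥0 ℝ) (1 / 2) = 1 / 2 := by simp [NNReal.algebraMap_eq_coe]
    simp only [Y, sqrtPoly, Polynomial.map_mul, Polynomial.map_add, Polynomial.map_C,
      Polynomial.map_X, Polynomial.map_pow, map_mul, map_add, map_pow, Polynomial.aeval_C,
      Polynomial.aeval_X, h2, Algebra.algebraMap_eq_smul_one, smul_mul_assoc, one_mul]
  have hYnorm : ∀ n, ‖Y n‖ ≤ 1 := fun n =>
    (norm_aeval_le A hAnorm _).trans (by exact_mod_cast sqrtPoly_eval_one_le n)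
  have hYsa : ∀ n, IsSelfAdjoint (Y n) := by
    intro n
    induction n with
    | zero => simp [Y, sqrtPoly]
    | succ n ih =>
      rw [hYs]
      exact isSelfAdjoint_smul _ _ (hAsa.add (ih.pow 2))
  let D : ℕ → H →L[ℝ] H := fun n =>
    Polynomial.aeval A ((sqrtIncr n).map (algebraMap ℝ≥0 ℝ))
  have hpart : ∀ n, ∑ i ∈ Finset.range n, sqrtIncr i = sqrtPoly n := by
    intro n
    induction n with
    | zero => simp [sqrtPoly]
    | succ n ih => rw [Finset.sum_range_succ, ih, sqrtPoly_succ]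
  have hYD : ∀ n, ∑ i ∈ Finset.range n, D i = Y n := by
    intro n
    simp only [D, Y]
    rw [← hpart n, Polynomial.map_sum, map_sum]
  have hsum : Summable fun n => (((sqrtIncr n).eval 1 : ℝ≥0) : ℝ) := by
    refine summable_of_sum_range_le (c := 1) (fun n => NNReal.coe_nonneg _) fun n => ?_
    rw [← NNReal.coe_sum, ← Polynomial.eval_finsetSum, hpart]
    exact_mod_cast sqrtPoly_eval_one_le n
  have hDsum : Summable D := Summable.of_norm_bounded hsum fun n => norm_aeval_le A hAnorm _
  obtain ⟨L, hL⟩ := hDsum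
  have hYL : Filter.Tendsto Y Filter.atTop (nhds L) := by
    have := hL.tendsto_sum_nat
    simpa only [hYD] using this
  have hLeq : L = (1 / 2 : ℝ) • (A + L ^ 2) := by
    have h1 := (Filter.tendsto_add_atTop_iff_nat 1).2 hYL
    have h2 : Filter.Tendsto (fun n => (1 / 2 : ℝ) • (A + Y n ^ 2)) Filter.atTop
        (nhds ((1 / 2 : ℝ) • (A + L ^ 2))) :=
      (tendsto_const_nhds.add (hYL.pow 2)).const_smul _
    simp only [hYs] at h1
    exact tendsto_nhds_unique h1 h2
  have hLnorm : ‖L‖ ≤ 1 := le_of_tendsto' hYL.norm hYnorm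
  have hLsa : IsSelfAdjoint L := by
    have h1 : Filter.Tendsto (fun n => star (Y n)) Filter.atTop (nhds (star L)) := hYL.star
    have h2 : (fun n => star (Y n)) = Y := funext fun n => (hYsa n).star_eq
    rw [h2] at h1
    exact tendsto_nhds_unique h1 hYL
  refine ⟨√‖T‖ • (1 - L), ?_, ?_⟩
  · rw [ContinuousLinearMap.isPositive_iff']
    refine ⟨isSelfAdjoint_smul _ _ ((IsSelfAdjoint.one _).sub hLsa), fun x => ?_⟩
    have h1 : inner ℝ (L x) x ≤ ‖x‖ ^ 2 := by
      refine (real_inner_le_norm _ _).trans ?_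
      have := L.le_of_opNorm_le hLnorm x
      nlinarith [norm_nonneg x]
    rw [smul_apply, real_inner_smul_left, sub_apply,
      inner_sub_left, one_apply_eq_self, real_inner_self_eq_norm_sq]
    exact mul_nonneg (Real.sqrt_nonneg _) (by linarith)
  · have h1 : (1 - L) * (1 - L) = B := by
      have h3 : (2 : ℝ) • L = A + L ^ 2 := by
        conv_lhs => rw [hLeq]
        rw [smul_smul]; norm_num
      have h4 : L * L = (2 : ℝ) • L - A := by rw [h3, pow_two]; abel
      rw [sub_mul, mul_sub, mul_sub, h4, hA, two_smul]
      simp only [one_mul, mul_one]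
      abel
    change (√‖T‖ • (1 - L)) * (√‖T‖ • (1 - L)) = T
    rw [smul_mul_smul_comm, h1, Real.mul_self_sqrt hc.le, hB, smul_smul,
      mul_inv_cancel₀ hc.ne', one_smul]

end SquareRoot

section Operators

variable {H : Type*} [NormedAddCommGroup H] [InnerProductSpace ℝ H] [CompleteSpace H]

open Classical in
/-- The positive square root `T ^ (1/2)` of a positive bounded operator `T`
(and `0` if `T` is not positive). -/
def sqrtOp (T : H →L[ℝ] H) : H →L[ℝ] H :=
  if hT : T.IsPositive then (exists_sqrt T hT).choose else 0

/-- The operator `T ^ (-1/2)`, in general unbounded: the inverse of `T ^ (1/2)`, with domain the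
range of `T ^ (1/2)`. If `T` is not injective, it is the inverse of the restriction of `T ^ (1/2)`
to the orthogonal complement of its kernel. -/
def invSqrtOp (T : H →L[ℝ] H) : H →ₗ.[ℝ] H :=
  ((sqrtOp T).toLinearMap.toPMap ((sqrtOp T).toLinearMap.ker)ᗮ).inverse

open Classical in
/-- The operator norm `‖T ^ (-1/2) R T ^ (-1/2) - I‖`, a supremum over the unit vectors of the
domain of `T ^ (-1/2)`. It is `∞` if the operator is unbounded, or if it is not defined
because `R` does not map into the domain of `T ^ (-1/2)`. -/
def whitenedNorm (T R : H →L[ℝ] H) : ℝ≥0∞ :=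
  if h : ∀ y, R y ∈ (invSqrtOp T).domain then
    ⨆ (x : (invSqrtOp T).domain) (_ : ‖(x : H)‖ = 1),
      ‖invSqrtOp T ⟨R (invSqrtOp T x), h _⟩ - (x : H)‖ₑ
  else ⊤

/-- The `k`-th largest eigenvalue (`k = 0, 1, …`) of a compact positive operator `T`, counted with
multiplicity, and `0` if `T` has at most `k` positive eigenvalues: the largest `t > 0` such that `T`
has `k + 1` orthonormal eigenvectors with eigenvalues at least `t`. -/
def eigenvalue (T : H →L[ℝ] H) (k : ℕ) : ℝ≥0∞ :=
  ⨆ (t : ℝ) (_ : 0 < t ∧ ∃ v : Fin (k + 1) → H, Orthonormal ℝ v ∧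
    ∀ i, ∃ μ : ℝ, t ≤ μ ∧ T (v i) = μ • v i), ENNReal.ofReal t

/-- The trace of a positive compact operator, as the sum of its eigenvalues. -/
def trace (T : H →L[ℝ] H) : ℝ≥0∞ := ∑' k, eigenvalue T k

/-- `Λ_{k+1}`, the square root of the sum of the squared eigenvalues `λ_j ^ 2`, `j ≥ k + 1`, with
eigenvalues numbered from `1`. -/
def tailNorm (T : H →L[ℝ] H) (k : ℕ) : ℝ≥0∞ :=
  (∑' j, eigenvalue T (k + j) ^ 2) ^ (1 / 2 : ℝ)

open Classical in
/-- The factor `ϰ(T)`, with values in `[0, ∞]`; it is `∞` if `T` has at most one positive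
eigenvalue. -/
def kappa (T : H →L[ℝ] H) : ℝ≥0∞ :=
  if 3 * eigenvalue T 0 ^ 2 ≤ tailNorm T 0 ^ 2 then (tailNorm T 0)⁻¹
  else if 3 * eigenvalue T 1 ^ 2 ≤ tailNorm T 1 ^ 2 then
    (eigenvalue T 0 * tailNorm T 1) ^ (-1 / 2 : ℝ)
  else (eigenvalue T 0 * eigenvalue T 1) ^ (-1 / 2 : ℝ)

/-- The covariance operator of the law of `X` (for a centered `X` with finite second moment),
characterized by `⟪cov P X u, v⟫ = E[⟪u, X⟫ ⟪v, X⟫]`. -/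
abbrev cov {Ω : Type*} [MeasurableSpace Ω] [MeasurableSpace H] [BorelSpace H]
    (P : Measure Ω) (X : Ω → H) : H →L[ℝ] H :=
  covarianceOperator (P.map X)

end Operators

end GaussianComparison

end

noncomputable section

namespace GaussianComparison

-- Write `T` and `R` for the covariance operators of `ξ` and `η`, and `δ` for the whitened norm. If
-- `δ ≥ 1/2`, the bound is trivial: `ϰ(T) ≥ 1/Λ₁ ≥ 1/tr T`, so the right side is at least a
-- constant, while a difference of probabilities is at most `1`. If `δ < 1/2`, then `|⟪R z, z⟫ - ⟪T
-- z, z⟫| ≤ δ ⟪T z, z⟫`, so with `c = 1 - δ` the form of `c T` lies below those of both `T` and `R`.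
-- In finitely many eigencoordinates of `T`, both laws are therefore that of a Gaussian vector `Z`
-- with covariance `c T` plus an independent Gaussian vector, whose covariance has trace at most `2
-- δ tr T`. It remains to compare both with `Z`.
--
-- Conditioning on the added vector turns the perturbation into a shift, so the core is a shift
-- inequality with a quadratic error: if `‖Z - a‖²` has concentration at most `K ε` on intervals of
-- length `ε`, for every `a`, then `0 ≤ P(‖Z‖² ≤ u) - P(‖Z - a‖² ≤ u) ≤ 2 K ‖a‖²`. Shifts are made
-- one coordinate at a time. The derivative in the centre `c` of the mass of a ball is `-(c/v)`
-- times the expectation of an exponential kernel, which concentration bounds by `4 v K`; the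
-- variance `v` cancels, and integrating `4 K c` gives `2 K b²`. Averaging over the added vector
-- replaces the squared shift by trace plus squared shift (`multivariateGaussian_ball_bounds`).
--
-- The concentration constant is of order `ϰ(T)` (`exists_finset_hasConc_kappa`). The characteristic
-- function of `‖Z - a‖²` is bounded by the product of `(1 + 4 t² λ²) ^ (-1/4)`. This is integrable
-- at scale `Λ₁` if no eigenvalue dominates; if one does, its factor is split off and the rest has
-- scale `Λ₂`; if two do, the planar density is bounded and an annulus has area at most `π ε`. The
-- estimates do not depend on the dimension, so they pass to the limit along finite sets of
-- eigenvectors.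

universe u

/-! ### Concentration from characteristic functions -/

/-- The characteristic function of `(X - a) ^ 2` for a centered Gaussian `X` of variance `v`
decays at least like the one of `X ^ 2`. -/
theorem norm_charFun_sq_sub_gaussian_le (v : ℝ≥0) (a t : ℝ) :
    ‖charFun ((gaussianReal 0 v).map fun x => (x - a) ^ 2) t‖
      ≤ (1 + 4 * t ^ 2 * (v : ℝ) ^ 2) ^ (-(1 / 4) : ℝ) := by
  rcases eq_or_ne v 0 with rfl | hv
  · have : IsProbabilityMeasure ((gaussianReal 0 0).map fun x => (x - a) ^ 2) :=
      Measure.isProbabilityMeasure_map (by fun_prop)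
    refine (norm_charFun_le_one t).trans_eq ?_
    rw [NNReal.coe_zero, zero_pow two_ne_zero, mul_zero, add_zero, Real.one_rpow]
  have hv0 : 0 < (v : ℝ) := by positivity
  rw [charFun_apply_real, integral_map (by fun_prop) (by fun_prop),
    integral_gaussianReal_eq_integral_smul hv]
  set b : ℂ := -(1 / (2 * v) : ℝ) + t * Complex.I with hb
  have hbre : b.re = -(1 / (2 * v) : ℝ) := by simp [hb]
  have hbim : b.im = t := by simp [hb]
  have hbneg : b.re < 0 := by rw [hbre]; simp only [Left.neg_neg_iff]; positivity
  have hb0 : b ≠ 0 := by intro h; rw [h] at hbneg; simp at hbneg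
  have h1 : ∀ x : ℝ, gaussianPDFReal 0 v x • Complex.exp (t * ((x - a) ^ 2 : ℝ) * Complex.I)
      = ((√(2 * Real.pi * v))⁻¹ : ℝ) * Complex.exp (b * x ^ 2 + (-2 * a * t * Complex.I) * x
        + t * a ^ 2 * Complex.I) := by
    intro x
    rw [gaussianPDFReal, Complex.real_smul, Complex.ofReal_mul, mul_assoc, Complex.ofReal_exp,
      ← Complex.exp_add]
    congr 2
    have : (v : ℂ) ≠ 0 := by exact_mod_cast hv
    simp only [hb]
    push_cast
    field_simp
    ring
  simp_rw [h1]
  rw [integral_const_mul, integral_cexp_quadratic hbneg, norm_mul, norm_mul, Complex.norm_exp,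
    Complex.norm_real]
  -- The shift `a` enters the modulus only through this exponent, whose real part is `a² t² Re(1/b)
  -- ≤ 0`. Hence no shift is the worst case.
  have hre : ((t * a ^ 2 * Complex.I - (-2 * a * t * Complex.I) ^ 2 / (4 * b) : ℂ)).re ≤ 0 := by
    have : (t * a ^ 2 * Complex.I - (-2 * a * t * Complex.I) ^ 2 / (4 * b) : ℂ)
        = ((t * a ^ 2 : ℝ) : ℂ) * Complex.I + ((a ^ 2 * t ^ 2 : ℝ) : ℂ) * b⁻¹ := by
      field_simp
      push_cast
      ring_nf
      rw [Complex.I_sq]; ring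
    rw [this, Complex.add_re, Complex.re_ofReal_mul, Complex.I_re, Complex.re_ofReal_mul,
      Complex.inv_re, mul_zero, zero_add]
    refine mul_nonpos_of_nonneg_of_nonpos (by positivity)
      (div_nonpos_of_nonpos_of_nonneg hbneg.le (Complex.normSq_nonneg _))
  have hnb : ‖b‖ = √(1 + 4 * t ^ 2 * (v : ℝ) ^ 2) / (2 * v) := by
    rw [Complex.norm_eq_sqrt_sq_add_sq, hbre, hbim, eq_div_iff (by positivity),
      ← Real.sqrt_sq (show 0 ≤ 2 * (v : ℝ) by positivity), ← Real.sqrt_mul (by positivity)]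
    congr 1
    rw [Real.sqrt_sq (by positivity)]
    field_simp
    ring
  have hcp : ‖((Real.pi : ℂ) / -b) ^ (1 / 2 : ℂ)‖ = (Real.pi / ‖b‖) ^ (1 / 2 : ℝ) := by
    have : (1 / 2 : ℂ) = ((1 / 2 : ℝ) : ℂ) := by push_cast; rfl
    rw [this, Complex.norm_cpow_real, norm_div, norm_neg, Complex.norm_real, Real.norm_eq_abs,
      abs_of_pos Real.pi_pos]
  rw [hcp, hnb, Real.norm_eq_abs, abs_of_nonneg (by positivity)]
  set w := 1 + 4 * t ^ 2 * (v : ℝ) ^ 2 with hw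
  have hwpos : 0 < w := by positivity
  have h2 : (Real.pi / (√w / (2 * v))) ^ (1 / 2 : ℝ)
      = √(2 * Real.pi * v) * w ^ (-(1 / 4) : ℝ) := by
    rw [show Real.pi / (√w / (2 * v)) = (2 * Real.pi * v) * (√w)⁻¹ by field_simp,
      Real.mul_rpow (by positivity) (by positivity), ← Real.sqrt_eq_rpow, Real.sqrt_eq_rpow w,
      ← Real.rpow_neg hwpos.le, ← Real.rpow_mul hwpos.le]
    norm_num
  rw [h2]
  have h3 : √(2 * Real.pi * v) ≠ 0 := by positivity
  rw [mul_assoc √(2 * Real.pi * v), inv_mul_cancel_left₀ h3]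
  exact mul_le_of_le_one_right (by positivity) (Real.exp_le_one_iff.2 hre)

/-- `Q` has concentration function at most `K ε` on intervals of length `ε`. -/
def HasConc {Ω : Type*} [MeasurableSpace Ω] (P : Measure Ω) (Q : Ω → ℝ) (K : ℝ) : Prop :=
  ∀ w ε : ℝ, 0 < ε → P {ω | w ≤ Q ω ∧ Q ω ≤ w + ε} ≤ ENNReal.ofReal (K * ε)

/-- A random variable with integrable characteristic function has bounded concentration. -/
theorem hasConc_of_charFun_le {Ω : Type*} [MeasurableSpace Ω] (P : Measure Ω)
    [IsProbabilityMeasure P] (Q : Ω → ℝ) (hQ : Measurable Q) (g : ℝ → ℝ) (hg : Integrable g)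
    (h : ∀ᵐ t, ‖charFun (P.map Q) t‖ ≤ g t) : HasConc P Q (∫ t, g t) := by
  intro w ε hε
  set ρ := P.map Q with hρ
  have : IsProbabilityMeasure ρ := Measure.isProbabilityMeasure_map hQ.aemeasurable
  set s : Set ℝ := Set.Icc w (w + ε) with hs
  have hPs : P {ω | w ≤ Q ω ∧ Q ω ≤ w + ε} = ρ s := by
    rw [hρ, Measure.map_apply hQ measurableSet_Icc]; rfl
  rw [hPs]
  set c := w + ε / 2 with hc
  -- The characteristic function of `N(0, q)` at `y - c` is `exp(-q (y - c)² / 2)`. For this `q` it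
  -- is at least `1/2` within distance `ε / 2` of `c`, while the density of `N(0, q)` is at most `ε
  -- / 4`.
  set q : ℝ≥0 := ⟨4 / ε ^ 2, by positivity⟩ with hq
  have hqc : (q : ℝ) = 4 / ε ^ 2 := rfl
  have hq0 : q ≠ 0 := by
    intro h0; have : (q : ℝ) = 0 := by rw [h0]; rfl
    rw [hqc] at this; exact absurd this (by positivity)
  set γ := gaussianReal 0 q with hγ
  have hchar : ∀ y : ℝ, ∫ x, Complex.exp (x * (y - c) * Complex.I) ∂γ
      = (Real.exp (-(q * (y - c) ^ 2 / 2)) : ℝ) := by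
    intro y
    have := charFun_gaussianReal (μ := 0) (v := q) (y - c)
    rw [charFun_apply_real] at this
    have e0 : ∀ x : ℝ, Complex.exp (x * (y - c) * Complex.I)
        = Complex.exp (((y - c : ℝ) : ℂ) * x * Complex.I) := by
      intro x; push_cast; ring_nf
    simp_rw [e0]
    rw [this]
    push_cast
    ring_nf
  -- Exchanging the integrals turns the smoothed indicator into an integral of the characteristic
  -- function of `Q` against the density of `N(0, q)`.
  have hfub : ∫ y, ∫ x, Complex.exp (x * (y - c) * Complex.I) ∂γ ∂ρ
      = ∫ x, ∫ y : ℝ, Complex.exp (x * (y - c) * Complex.I) ∂ρ ∂γ := by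
    refine integral_integral_swap ?_
    refine Integrable.of_bound (C := 1) (by fun_prop) (Filter.Eventually.of_forall fun p => ?_)
    simp only [Function.uncurry]
    rw [show (p.2 * (p.1 - c) * Complex.I : ℂ) = ((p.2 * (p.1 - c) : ℝ) : ℂ) * Complex.I by
      push_cast; ring, Complex.norm_exp_ofReal_mul_I]
  have hinner : ∀ᵐ x : ℝ, ‖∫ y : ℝ, Complex.exp (x * (y - c) * Complex.I) ∂ρ‖ ≤ g x := by
    filter_upwards [h] with x hx
    have : ∀ y : ℝ, Complex.exp (x * (y - c) * Complex.I)
        = Complex.exp ((-(x * c) : ℝ) * Complex.I) * Complex.exp (x * y * Complex.I) := by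
      intro y; rw [← Complex.exp_add]; push_cast; ring_nf
    simp_rw [this]
    rw [integral_const_mul, norm_mul, Complex.norm_exp_ofReal_mul_I, one_mul, ← charFun_apply_real]
    exact hx
  have hpdf : ∀ x, gaussianPDFReal 0 q x ≤ (√(2 * Real.pi * q))⁻¹ := by
    intro x
    rw [gaussianPDFReal]
    refine mul_le_of_le_one_right (by positivity) (Real.exp_le_one_iff.2 ?_)
    exact div_nonpos_of_nonpos_of_nonneg (by nlinarith [sq_nonneg (x - 0)]) (by positivity)
  have hsq : (√(2 * Real.pi * q))⁻¹ ≤ ε / 4 := by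
    have h4 : (4 / ε) ≤ √(2 * Real.pi * q) := by
      refine Real.le_sqrt_of_sq_le ?_
      rw [hqc, div_pow, show 2 * Real.pi * (4 / ε ^ 2) = 8 * Real.pi / ε ^ 2 by ring]
      gcongr
      nlinarith [Real.pi_gt_three]
    calc (√(2 * Real.pi * q))⁻¹ ≤ (4 / ε)⁻¹ := inv_anti₀ (by positivity) h4
      _ = ε / 4 := by rw [inv_div]
  have hbound : ∫ y, Real.exp (-(q * (y - c) ^ 2 / 2)) ∂ρ ≤ ε / 4 * ∫ t, g t := by
    have e1 : ((∫ y, Real.exp (-(q * (y - c) ^ 2 / 2)) ∂ρ : ℝ) : ℂ)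
        = ∫ x, ∫ y : ℝ, Complex.exp (x * (y - c) * Complex.I) ∂ρ ∂γ := by
      rw [← hfub, ← integral_complex_ofReal]
      simp_rw [hchar]
    have e2 : ∫ y, Real.exp (-(q * (y - c) ^ 2 / 2)) ∂ρ
        = ‖∫ x, ∫ y : ℝ, Complex.exp (x * (y - c) * Complex.I) ∂ρ ∂γ‖ := by
      rw [← e1, Complex.norm_real, Real.norm_of_nonneg (integral_nonneg fun _ => (Real.exp_pos _).le)]
    rw [e2, hγ, integral_gaussianReal_eq_integral_smul hq0, ← integral_const_mul]
    refine norm_integral_le_of_norm_le (hg.const_mul _) ?_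
    filter_upwards [hinner] with x hx
    rw [norm_smul, Real.norm_of_nonneg (gaussianPDFReal_nonneg _ _ _)]
    exact mul_le_mul ((hpdf x).trans hsq) hx (norm_nonneg _) (by positivity)
  have hind : ρ.real s ≤ 4 * ∫ y, Real.exp (-(q * (y - c) ^ 2 / 2)) ∂ρ := by
    have hint : Integrable (fun y => 4 * Real.exp (-(q * (y - c) ^ 2 / 2))) ρ := by
      refine Integrable.of_bound (C := 4) (by fun_prop) (Filter.Eventually.of_forall fun y => ?_)
      rw [Real.norm_of_nonneg (by positivity)]
      have : Real.exp (-(q * (y - c) ^ 2 / 2)) ≤ 1 :=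
        Real.exp_le_one_iff.2 (neg_nonpos.2 (by positivity))
      linarith
    rw [← integral_const_mul, ← integral_indicator_one measurableSet_Icc]
    refine integral_mono (by
      exact (integrable_indicator_iff measurableSet_Icc).2 (integrable_const _).integrableOn)
      hint fun y => ?_
    by_cases hy : y ∈ s
    · rw [Set.indicator_of_mem hy]
      have h5 : (q : ℝ) * (y - c) ^ 2 / 2 ≤ 1 / 2 := by
        have h6 : (y - c) ^ 2 ≤ (ε / 2) ^ 2 := by
          rw [hs, Set.mem_Icc] at hy
          refine sq_le_sq' ?_ ?_ <;> rw [hc] <;> linarith [hy.1, hy.2]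
        rw [hqc]
        have : 4 / ε ^ 2 * (y - c) ^ 2 ≤ 4 / ε ^ 2 * (ε / 2) ^ 2 := by gcongr
        have h7 : 4 / ε ^ 2 * (ε / 2) ^ 2 = 1 := by field_simp; ring
        linarith
      have h8 : 1 + (-(q * (y - c) ^ 2 / 2)) ≤ Real.exp (-(q * (y - c) ^ 2 / 2)) := by
        linarith [Real.add_one_le_exp (-((q : ℝ) * (y - c) ^ 2 / 2))]
      simp only [Pi.one_apply]
      linarith
    · rw [Set.indicator_of_notMem hy]; positivity
  rw [← ofReal_measureReal]
  refine ENNReal.ofReal_le_ofReal ?_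
  linarith

/-- Since `x i / m` lies in `[0, 1]`, Bernoulli's inequality gives `(1 + m) ^ (x i / m) ≤ 1 + x i`;
multiplying adds up the exponents to at least `p`. -/
theorem one_add_rpow_le_prod {ι : Type*} (J : Finset ι) (x : ι → ℝ) {m p : ℝ} (hm : 0 < m)
    (h0 : ∀ i ∈ J, 0 ≤ x i) (hxm : ∀ i ∈ J, x i ≤ m) (hp : p * m ≤ ∑ i ∈ J, x i) :
    (1 + m) ^ p ≤ ∏ i ∈ J, (1 + x i) := by
  have h1 : (1 + m) ^ p ≤ (1 + m) ^ (∑ i ∈ J, x i / m) := by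
    refine Real.rpow_le_rpow_of_exponent_le (by linarith) ?_
    rw [← Finset.sum_div, le_div_iff₀ hm]
    exact hp
  refine h1.trans ?_
  rw [Real.rpow_sum_of_pos (by linarith)]
  refine Finset.prod_le_prod (fun i _ => by positivity) fun i hi => ?_
  refine (_root_.rpow_one_add_le_one_add_mul_self (by linarith) (div_nonneg (h0 i hi) hm.le)
    ((div_le_one hm).2 (hxm i hi))).trans_eq ?_
  rw [div_mul_cancel₀ _ hm.ne']

/-! ### Squared distances: spread spectrum and one dominant eigenvalue -/

section SquaredDistance

variable {ι : Type*} [Fintype ι]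

/-- The law of independent centered Gaussian variables with variances `v i`. -/
abbrev gaussPi (v : ι → ℝ≥0) : Measure (ι → ℝ) := Measure.pi fun i => gaussianReal 0 (v i)

/-- The squared Euclidean distance of `x` and `a`. -/
def sqDist (a x : ι → ℝ) : ℝ := ∑ i, (x i - a i) ^ 2

@[fun_prop]
theorem measurable_sqDist (a : ι → ℝ) : Measurable (sqDist a) := by
  unfold sqDist; fun_prop

/-- Independence factorizes the characteristic function. The bounds for the coordinates outside `J`
are at most `1` and may be dropped, so only a well-chosen `J` matters. -/
theorem norm_charFun_sqDist_le (v : ι → ℝ≥0) (a : ι → ℝ) (J : Finset ι) (t : ℝ) :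
    ‖charFun ((gaussPi v).map (sqDist a)) t‖
      ≤ ∏ i ∈ J, (1 + 4 * t ^ 2 * (v i : ℝ) ^ 2) ^ (-(1 / 4) : ℝ) := by
  have hind : iIndepFun (fun i (x : ι → ℝ) => (x i - a i) ^ 2) (gaussPi v) :=
    iIndepFun_pi (X := fun i y => (y - a i) ^ 2) fun i => by fun_prop
  have h1 := hind.charFun_map_fun_sum_eq_prod (fun i => Measurable.aemeasurable (by fun_prop))
  change ‖charFun ((gaussPi v).map (fun x => ∑ i, (x i - a i) ^ 2)) t‖ ≤ _
  rw [h1, Finset.prod_apply, norm_prod]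
  have h2 : ∀ i, ‖charFun ((gaussPi v).map fun x => (x i - a i) ^ 2) t‖
      ≤ (1 + 4 * t ^ 2 * (v i : ℝ) ^ 2) ^ (-(1 / 4) : ℝ) := by
    intro i
    have h3 : (gaussPi v).map (fun x => (x i - a i) ^ 2)
        = (gaussianReal 0 (v i)).map fun y => (y - a i) ^ 2 := by
      rw [← (measurePreserving_eval (fun i => gaussianReal 0 (v i)) i).map_eq,
        Measure.map_map (by fun_prop) (by fun_prop)]
      rfl
    rw [h3]
    exact norm_charFun_sq_sub_gaussian_le _ _ _
  refine (Finset.prod_le_prod (fun i _ => norm_nonneg _) fun i _ => h2 i).trans ?_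
  refine Finset.prod_le_prod_of_subset_of_le_one (Finset.subset_univ J)
    (fun i _ => by positivity) fun i _ _ => ?_
  exact Real.rpow_le_one_of_one_le_of_nonpos
    (by have : 0 ≤ 4 * t ^ 2 * (v i : ℝ) ^ 2 := by positivity
        linarith) (by norm_num)

/-- The product is as small as if `5/2` factors had the maximal size `m`. The exponent `5/2 · 1/4 =
5/8` gives decay `|t| ^ (-5/4)`, which is integrable. The definition of `ϰ` offers `3` in place of
`5/2`; the gap absorbs the approximation of the spectrum by finitely many eigenvectors. -/
theorem prod_rpow_le_of_sum_le {ι : Type*} (v : ι → ℝ≥0) (J : Finset ι) {m t : ℝ} (hm : 0 < m)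
    (hJ : ∀ i ∈ J, (v i : ℝ) ^ 2 ≤ m) (hsum : 5 / 2 * m ≤ ∑ i ∈ J, (v i : ℝ) ^ 2) :
    ∏ i ∈ J, (1 + 4 * t ^ 2 * (v i : ℝ) ^ 2) ^ (-(1 / 4) : ℝ)
      ≤ (1 + (2 * √m * t) ^ 2) ^ (-(5 / 8) : ℝ) := by
  rcases eq_or_ne t 0 with rfl | ht
  · simp
  have ht2 : 0 < 4 * t ^ 2 := by positivity
  have h := one_add_rpow_le_prod J (fun i => 4 * t ^ 2 * (v i : ℝ) ^ 2) (m := 4 * t ^ 2 * m)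
    (p := 5 / 2) (by positivity) (fun i _ => by positivity)
    (fun i hi => mul_le_mul_of_nonneg_left (hJ i hi) ht2.le)
    (by rw [← Finset.mul_sum]; nlinarith)
  have e : 4 * t ^ 2 * m = (2 * √m * t) ^ 2 := by
    rw [mul_pow, mul_pow, Real.sq_sqrt hm.le]; ring
  rw [Real.finsetProd_rpow _ _ (fun i _ => by positivity), ← e]
  refine (Real.rpow_le_rpow_of_nonpos (by positivity) h (by norm_num)).trans_eq ?_
  rw [← Real.rpow_mul (by positivity)]
  norm_num

/-- The profile of the bound for the characteristic function when no eigenvalue dominates. -/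
def profile (s : ℝ) : ℝ := (1 + s ^ 2) ^ (-(5 / 8) : ℝ)

/-- The profile of the bound for the characteristic function when one eigenvalue dominates. -/
def singularProfile (s : ℝ) : ℝ := |s| ^ (-(1 / 2) : ℝ) * profile s

theorem profile_nonneg (s : ℝ) : 0 ≤ profile s := by unfold profile; positivity

theorem integrable_profile : Integrable profile := by
  have := integrable_rpow_neg_one_add_norm_sq (E := ℝ) (μ := volume) (r := 5 / 4) (by simp; norm_num)
  refine this.congr (Filter.Eventually.of_forall fun s => ?_)
  simp only [profile, Real.norm_eq_abs, sq_abs]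
  norm_num

/-- On `[-1, 1]` the function is dominated by the integrable singularity `|s| ^ (-1/2)`, elsewhere
by `profile`. -/
theorem integrable_singularProfile : Integrable singularProfile := by
  have hm : Measurable singularProfile := by unfold singularProfile profile; fun_prop
  have hpos : IntegrableOn (fun s : ℝ => |s| ^ (-(1 / 2) : ℝ)) (Set.Ioc 0 1) := by
    have h := intervalIntegral.intervalIntegrable_rpow' (a := 0) (b := 1)
      (r := -(1 / 2)) (by norm_num)
    rw [intervalIntegrable_iff_integrableOn_Ioc_of_le zero_le_one] at h
    exact h.congr_fun (fun s hs => by simp only [abs_of_pos hs.1]) measurableSet_Ioc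
  have hneg : IntegrableOn (fun s : ℝ => |s| ^ (-(1 / 2) : ℝ)) (Set.Ico (-1) 0) := by
    have := hpos.comp_neg
    simpa using this
  have hall : IntegrableOn (fun s : ℝ => |s| ^ (-(1 / 2) : ℝ)) (Set.Icc (-1) 1) := by
    refine ((hneg.union hpos).union (integrableOn_singleton (x := (0 : ℝ)) (by simp) (by simp))).mono_set ?_
    intro s hs
    rcases lt_trichotomy s 0 with h | h | h
    · exact Or.inl (Or.inl ⟨hs.1, h⟩)
    · exact Or.inr h
    · exact Or.inl (Or.inr ⟨h, hs.2⟩)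
  have hind := (integrable_indicator_iff measurableSet_Icc).2 hall
  refine (hind.add integrable_profile).mono' hm.aestronglyMeasurable
    (Filter.Eventually.of_forall fun s => ?_)
  have hp1 : profile s ≤ 1 := Real.rpow_le_one_of_one_le_of_nonpos (by nlinarith [sq_nonneg s])
    (by norm_num)
  have hp0 := profile_nonneg s
  have hr0 : 0 ≤ |s| ^ (-(1 / 2) : ℝ) := by positivity
  rw [singularProfile, Real.norm_of_nonneg (mul_nonneg hr0 hp0), Pi.add_apply]
  by_cases hs : s ∈ Set.Icc (-1 : ℝ) 1
  · rw [Set.indicator_of_mem hs]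
    nlinarith
  · rw [Set.indicator_of_notMem hs, zero_add]
    refine mul_le_of_le_one_left hp0 (Real.rpow_le_one_of_one_le_of_nonpos ?_ (by norm_num))
    rw [Set.mem_Icc, ← abs_le, not_le] at hs
    exact hs.le

theorem integral_singularProfile_nonneg : 0 ≤ ∫ s, singularProfile s :=
  integral_nonneg fun s => mul_nonneg (by positivity) (profile_nonneg s)

/-- Concentration of the squared distance when no eigenvalue dominates. -/
theorem hasConc_sqDist_of_spread (v : ι → ℝ≥0) (J : Finset ι) {m : ℝ} (hm : 0 < m)
    (hJ : ∀ i ∈ J, (v i : ℝ) ^ 2 ≤ m) (hsum : 5 / 2 * m ≤ ∑ i ∈ J, (v i : ℝ) ^ 2)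
    (a : ι → ℝ) : HasConc (gaussPi v) (sqDist a) ((2 * √m)⁻¹ * ∫ s, profile s) := by
  have hm0 : 2 * √m ≠ 0 := by positivity
  have h := hasConc_of_charFun_le (gaussPi v) (sqDist a) (measurable_sqDist a)
    (fun t => profile (2 * √m * t)) (integrable_profile.comp_mul_left' hm0)
    (Filter.Eventually.of_forall fun t =>
      (norm_charFun_sqDist_le v a J t).trans (prod_rpow_le_of_sum_le v J hm hJ hsum))
  rwa [Measure.integral_comp_mul_left, smul_eq_mul, abs_of_nonneg (by positivity)] at h

/-- Concentration of the squared distance when one eigenvalue dominates. -/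
theorem hasConc_sqDist_of_dominant [DecidableEq ι] (v : ι → ℝ≥0) (J : Finset ι) {m : ℝ}
    (hm : 0 < m) (hJ : ∀ i ∈ J, (v i : ℝ) ^ 2 ≤ m)
    (hsum : 5 / 2 * m ≤ ∑ i ∈ J, (v i : ℝ) ^ 2) {i₀ : ι} (hi₀ : i₀ ∉ J) (hv : 0 < v i₀)
    (a : ι → ℝ) : HasConc (gaussPi v) (sqDist a)
      ((2 * √(v i₀ * √m))⁻¹ * ∫ s, singularProfile s) := by
  have hv' : (0 : ℝ) < v i₀ := hv
  set q := 2 * √m with hq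
  have hq0 : 0 < q := by positivity
  -- For `t ≠ 0` the dominant factor is at most `(2 v |t|) ^ (-1/2)`, which is `k |q t| ^ (-1/2)`;
  -- this constant puts both factors on the common scale `q`.
  set k := (2 * (v i₀ : ℝ)) ^ (-(1 / 2) : ℝ) * q ^ (1 / 2 : ℝ) with hk
  have h := hasConc_of_charFun_le (gaussPi v) (sqDist a) (measurable_sqDist a)
    (fun t => k * singularProfile (q * t))
    ((integrable_singularProfile.comp_mul_left' hq0.ne').const_mul k) (by
      filter_upwards [Measure.ae_ne volume (0 : ℝ)] with t ht
      refine (norm_charFun_sqDist_le v a (insert i₀ J) t).trans ?_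
      rw [Finset.prod_insert hi₀, singularProfile, ← mul_assoc]
      refine mul_le_mul ?_ (prod_rpow_le_of_sum_le v J hm hJ hsum)
        (Finset.prod_nonneg fun i _ => by positivity) (by positivity)
      have ht0 : 0 < |t| := abs_pos.2 ht
      have e1 : (1 + 4 * t ^ 2 * (v i₀ : ℝ) ^ 2) ^ (-(1 / 4) : ℝ)
          ≤ ((2 * v i₀ * |t|) ^ 2) ^ (-(1 / 4) : ℝ) := by
        refine Real.rpow_le_rpow_of_nonpos (by positivity) ?_ (by norm_num)
        rw [mul_pow, sq_abs]; nlinarith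
      refine e1.trans_eq ?_
      rw [← Real.rpow_natCast, ← Real.rpow_mul (by positivity), hk, abs_mul, abs_of_pos hq0,
        Real.mul_rpow (by positivity) (by positivity), Real.mul_rpow hq0.le (by positivity),
        mul_assoc, ← mul_assoc (q ^ _), ← Real.rpow_add hq0]
      norm_num)
  rw [integral_const_mul, Measure.integral_comp_mul_left, smul_eq_mul,
    abs_of_nonneg (by positivity), ← mul_assoc] at h
  have e2 : k * q⁻¹ = (2 * √(v i₀ * √m))⁻¹ := by
    have e3 : q⁻¹ = q ^ (-1 : ℝ) := (Real.rpow_neg_one q).symm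
    rw [hk, e3, mul_assoc, ← Real.rpow_add hq0,
      show (1 / 2 + -1 : ℝ) = -(1 / 2) by norm_num, ← Real.mul_rpow (by positivity) hq0.le,
      Real.rpow_neg (by positivity), ← Real.sqrt_eq_rpow]
    congr 1
    rw [hq, show 2 * (v i₀ : ℝ) * (2 * √m) = 2 ^ 2 * (v i₀ * √m) by ring,
      Real.sqrt_mul (by positivity), Real.sqrt_sq (by norm_num)]
  rwa [e2] at h

end SquaredDistance

/-! ### Squared distances: two dominant eigenvalues -/

theorem measure_eq_lintegral_of_indepFun {Ω α β : Type*} [MeasurableSpace Ω] [MeasurableSpace α]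
    [MeasurableSpace β] {P : Measure Ω} [IsProbabilityMeasure P] {Y : Ω → α} {R : Ω → β}
    (hY : Measurable Y) (hR : Measurable R) (h : IndepFun Y R P) {B : Set (α × β)}
    (hB : MeasurableSet B) :
    P {ω | (Y ω, R ω) ∈ B} = ∫⁻ r, P.map Y {y | (y, r) ∈ B} ∂(P.map R) := by
  have : IsProbabilityMeasure (P.map Y) := Measure.isProbabilityMeasure_map hY.aemeasurable
  have : IsProbabilityMeasure (P.map R) := Measure.isProbabilityMeasure_map hR.aemeasurable
  have h1 := (indepFun_iff_map_prod_eq_prod_map_map hY.aemeasurable hR.aemeasurable).1 h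
  have h2 : P {ω | (Y ω, R ω) ∈ B} = P.map (fun ω => (Y ω, R ω)) B := by
    rw [Measure.map_apply (hY.prodMk hR) hB]; rfl
  rw [h2, h1, Measure.prod_apply_symm hB]
  rfl

/-- The squared radii differ by at most `ε`, so the area does not depend on the size of the annulus.
For negative `w` the inner radius `√w` is `0`. -/
theorem volume_annulus_le (a b w ε : ℝ) (hε : 0 < ε) :
    volume {y : ℝ × ℝ | w ≤ (y.1 - a) ^ 2 + (y.2 - b) ^ 2 ∧ (y.1 - a) ^ 2 + (y.2 - b) ^ 2 ≤ w + ε}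
      ≤ ENNReal.ofReal (Real.pi * ε) := by
  have hmeas : MeasurableSet {y : ℝ × ℝ | w ≤ (y.1 - a) ^ 2 + (y.2 - b) ^ 2 ∧
      (y.1 - a) ^ 2 + (y.2 - b) ^ 2 ≤ w + ε} := by measurability
  rw [← Complex.volume_preserving_equiv_real_prod.measure_preimage hmeas.nullMeasurableSet]
  set c : ℂ := ⟨a, b⟩
  have hsub : Complex.measurableEquivRealProd ⁻¹' {y : ℝ × ℝ | w ≤ (y.1 - a) ^ 2 + (y.2 - b) ^ 2 ∧
      (y.1 - a) ^ 2 + (y.2 - b) ^ 2 ≤ w + ε} ⊆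
      Metric.closedBall c √(w + ε) \ Metric.ball c √w := by
    rintro z ⟨h1, h2⟩
    simp only [Complex.measurableEquivRealProd_apply] at h1 h2
    have h3 : dist z c = √((z.re - a) ^ 2 + (z.im - b) ^ 2) := by
      rw [Complex.dist_eq_re_im]
    refine ⟨?_, ?_⟩
    · rw [Metric.mem_closedBall, h3]; exact Real.sqrt_le_sqrt h2
    · rw [Metric.mem_ball, h3, not_lt]; exact Real.sqrt_le_sqrt h1
  refine (measure_mono hsub).trans ?_
  have hle : √w ≤ √(w + ε) := Real.sqrt_le_sqrt (by linarith)
  rw [measure_sdiff (Metric.ball_subset_closedBall.trans (Metric.closedBall_subset_closedBall hle))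
    measurableSet_ball.nullMeasurableSet (by rw [Complex.volume_ball]; finiteness),
    Complex.volume_ball, Complex.volume_closedBall]
  have hpi : (NNReal.pi : ℝ≥0∞) = ENNReal.ofReal Real.pi := by
    rw [← NNReal.coe_real_pi, ENNReal.ofReal_coe_nnreal]
  rw [hpi, ← ENNReal.ofReal_pow (Real.sqrt_nonneg _), ← ENNReal.ofReal_pow (Real.sqrt_nonneg _),
    ← ENNReal.ofReal_mul (by positivity), ← ENNReal.ofReal_mul (by positivity),
    ← ENNReal.ofReal_sub _ (by positivity)]
  refine ENNReal.ofReal_le_ofReal ?_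
  have h4 : √(w + ε) ^ 2 - √w ^ 2 ≤ ε := by
    rcases le_total 0 w with hw | hw
    · rw [Real.sq_sqrt hw, Real.sq_sqrt (by linarith)]; linarith
    · rw [Real.sqrt_eq_zero_of_nonpos hw]
      rcases le_total 0 (w + ε) with h | h
      · rw [Real.sq_sqrt h]; linarith
      · rw [Real.sqrt_eq_zero_of_nonpos h]; simpa using hε.le
  nlinarith [Real.pi_pos]

theorem gaussianReal_le_smul_volume {v : ℝ≥0} (hv : v ≠ 0) :
    gaussianReal 0 v ≤ ENNReal.ofReal (√(2 * Real.pi * v))⁻¹ • volume := by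
  rw [gaussianReal_of_var_ne_zero _ hv, ← withDensity_const]
  refine withDensity_mono (Filter.Eventually.of_forall fun x => ?_)
  refine ENNReal.ofReal_le_ofReal ?_
  rw [gaussianPDFReal]
  refine mul_le_of_le_one_right (by positivity) (Real.exp_le_one_iff.2 ?_)
  exact div_nonpos_of_nonpos_of_nonneg (by nlinarith [sq_nonneg (x - 0)]) (by positivity)

/-- The planar density is at most `1 / (2 π √(v₀ v₁))`, and the area of the annulus is at most `π
ε`. -/
theorem prod_gaussianReal_annulus_le {v₀ v₁ : ℝ≥0} (h₀ : v₀ ≠ 0) (h₁ : v₁ ≠ 0) (a b w ε : ℝ)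
    (hε : 0 < ε) : (gaussianReal 0 v₀).prod (gaussianReal 0 v₁)
      {y : ℝ × ℝ | w ≤ (y.1 - a) ^ 2 + (y.2 - b) ^ 2 ∧ (y.1 - a) ^ 2 + (y.2 - b) ^ 2 ≤ w + ε}
      ≤ ENNReal.ofReal ((2 * √(v₀ * v₁))⁻¹ * ε) := by
  have hle : (gaussianReal 0 v₀).prod (gaussianReal 0 v₁)
      ≤ (ENNReal.ofReal (√(2 * Real.pi * v₀))⁻¹ * ENNReal.ofReal (√(2 * Real.pi * v₁))⁻¹)
        • (volume : Measure (ℝ × ℝ)) := by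
    rw [Measure.le_iff]
    intro s hs
    rw [Measure.prod_apply hs, Measure.smul_apply, smul_eq_mul, Measure.volume_eq_prod,
      Measure.prod_apply hs, mul_assoc, ← lintegral_const_mul' _ _ (by finiteness),
      ← smul_eq_mul, ← lintegral_smul_measure]
    refine lintegral_mono' (gaussianReal_le_smul_volume h₀) fun x => ?_
    have := gaussianReal_le_smul_volume h₁ (Prod.mk x ⁻¹' s)
    simpa using this
  refine (hle _).trans ?_
  rw [Measure.smul_apply, smul_eq_mul]
  refine (mul_le_mul_right (volume_annulus_le a b w ε hε) _).trans_eq ?_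
  rw [← ENNReal.ofReal_mul (by positivity), ← ENNReal.ofReal_mul (by positivity)]
  congr 1
  have h0' : 0 < (v₀ : ℝ) := by positivity
  have h1' : 0 < (v₁ : ℝ) := by positivity
  have e : √(2 * Real.pi * v₀) * √(2 * Real.pi * v₁) = 2 * Real.pi * √(v₀ * v₁) := by
    rw [← Real.sqrt_mul (by positivity), show 2 * Real.pi * (v₀ : ℝ) * (2 * Real.pi * v₁)
      = (2 * Real.pi) ^ 2 * (v₀ * v₁) by ring, Real.sqrt_mul (by positivity),
      Real.sqrt_sq (by positivity)]
  rw [← mul_inv, e]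
  field_simp

section TwoEigenvalues

variable {ι : Type*} [Fintype ι]

theorem gaussPi_map_eval (v : ι → ℝ≥0) (i : ι) :
    (gaussPi v).map (fun x => x i) = gaussianReal 0 (v i) :=
  (measurePreserving_eval (fun i => gaussianReal 0 (v i)) i).map_eq

theorem iIndepFun_eval_gaussPi (v : ι → ℝ≥0) :
    iIndepFun (fun i (x : ι → ℝ) => x i) (gaussPi v) :=
  iIndepFun_pi (X := fun _ y => y) fun i => by fun_prop

variable [DecidableEq ι]

/-- Concentration of the squared distance from two eigenvalues. -/
theorem hasConc_sqDist_of_pair (v : ι → ℝ≥0) {i₀ i₁ : ι} (hne : i₀ ≠ i₁) (h₀ : v i₀ ≠ 0)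
    (h₁ : v i₁ ≠ 0) (a : ι → ℝ) :
    HasConc (gaussPi v) (sqDist a) (2 * √(v i₀ * v i₁))⁻¹ := by
  intro w ε hε
  set Y : (ι → ℝ) → ℝ × ℝ := fun x => (x i₀, x i₁) with hY
  set J : Finset ι := {i₀, i₁} with hJ
  set R : (ι → ℝ) → ℝ := fun x => ∑ i ∈ Jᶜ, (x i - a i) ^ 2 with hR
  have hYm : Measurable Y := by fun_prop
  have hRm : Measurable R := by fun_prop
  have hind : IndepFun Y R (gaussPi v) := by
    have h := (iIndepFun_eval_gaussPi v).indepFun_finset J Jᶜ disjoint_compl_right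
      (fun i => by fun_prop)
    exact h.comp (φ := fun p : J → ℝ => (p ⟨i₀, by simp [hJ]⟩, p ⟨i₁, by simp [hJ]⟩))
      (ψ := fun p : (Jᶜ : Finset ι) → ℝ => ∑ i, (p i - a i) ^ 2)
      (by fun_prop) (by fun_prop) |>.congr (Filter.EventuallyEq.refl _ _)
      (Filter.Eventually.of_forall fun x => by
        simp only [hR, Function.comp]
        exact Finset.sum_coe_sort Jᶜ (fun i => (x i - a i) ^ 2))
  have hYlaw : (gaussPi v).map Y = (gaussianReal 0 (v i₀)).prod (gaussianReal 0 (v i₁)) := by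
    rw [hY, (indepFun_iff_map_prod_eq_prod_map_map
      (measurable_pi_apply i₀).aemeasurable (measurable_pi_apply i₁).aemeasurable).1
      ((iIndepFun_eval_gaussPi v).indepFun hne), gaussPi_map_eval, gaussPi_map_eval]
  set B : Set ((ℝ × ℝ) × ℝ) := {p | w ≤ (p.1.1 - a i₀) ^ 2 + (p.1.2 - a i₁) ^ 2 + p.2 ∧
    (p.1.1 - a i₀) ^ 2 + (p.1.2 - a i₁) ^ 2 + p.2 ≤ w + ε} with hB
  have hBm : MeasurableSet B := by measurability
  have hset : {x | w ≤ sqDist a x ∧ sqDist a x ≤ w + ε} = {x | (Y x, R x) ∈ B} := by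
    ext x
    have : sqDist a x = (x i₀ - a i₀) ^ 2 + (x i₁ - a i₁) ^ 2 + R x := by
      rw [sqDist, ← Finset.sum_add_sum_compl J, hJ, Finset.sum_pair hne]
    simp only [hB, hY, Set.mem_ofPred_eq, this]
  rw [hset, measure_eq_lintegral_of_indepFun hYm hRm hind hBm]
  have : IsProbabilityMeasure ((gaussPi v).map R) :=
    Measure.isProbabilityMeasure_map hRm.aemeasurable
  -- Once the remaining coordinates are fixed, the event is an annulus in the plane of the two
  -- chosen ones, and the bound does not depend on the fixed value `r`.
  calc _ ≤ ∫⁻ _, ENNReal.ofReal ((2 * √(v i₀ * v i₁))⁻¹ * ε) ∂((gaussPi v).map R) := by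
        refine lintegral_mono fun r => ?_
        rw [hYlaw]
        refine le_trans (measure_mono ?_)
          (prod_gaussianReal_annulus_le h₀ h₁ (a i₀) (a i₁) (w - r) ε hε)
        rintro y ⟨h1, h2⟩
        exact ⟨by linarith, by linarith⟩
    _ = _ := by simp

end TwoEigenvalues

/-! ### The effect of shifting one Gaussian coordinate -/

/-- The exponential kernel of mean `2 v` on the half line, without its normalization. -/
def expKernel (v : ℝ≥0) (y : ℝ) : ℝ≥0∞ :=
  if 0 ≤ y then ENNReal.ofReal (Real.exp (-(y / (2 * v)))) else 0

@[fun_prop]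
theorem measurable_expKernel (v : ℝ≥0) : Measurable (expKernel v) :=
  Measurable.ite measurableSet_Ici (by fun_prop) measurable_const

theorem setOf_sq_sub_le_eq_Icc {u : ℝ} (hu : 0 ≤ u) (b : ℝ) :
    {x : ℝ | (x - b) ^ 2 ≤ u} = Set.Icc (b - √u) (b + √u) := by
  ext x
  rw [Set.mem_ofPred_eq, Real.sq_le hu, Set.mem_Icc]
  constructor <;> rintro ⟨h1, h2⟩ <;> constructor <;> linarith

/-- The kernel cancels the quadratic term of the Gaussian exponent, leaving `exp` of an affine
function of `x`, with logarithmic derivative `-c / v`. The factor `c / v` gives it an explicit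
antiderivative, and at the endpoints `c ± √u` the kernel is `1`, so only values of the density
remain. -/
theorem lintegral_expKernel_gaussianReal {v : ℝ≥0} (hv : v ≠ 0) {u c : ℝ} (hu : 0 ≤ u)
    (hc : 0 ≤ c) :
    ENNReal.ofReal (c / v) * ∫⁻ x, expKernel v (u - (x - c) ^ 2) ∂(gaussianReal 0 v)
      = ENNReal.ofReal (gaussianPDFReal 0 v (c - √u) - gaussianPDFReal 0 v (c + √u)) := by
  set r := √u with hr
  have hr2 : r ^ 2 = u := Real.sq_sqrt hu
  have hr0 : 0 ≤ r := Real.sqrt_nonneg u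
  have hv' : (0 : ℝ) < v := by positivity
  set E : ℝ → ℝ := fun x => (√(2 * Real.pi * v))⁻¹ * Real.exp (-(u + 2 * x * c - c ^ 2) / (2 * v))
    with hE
  have hEpos : ∀ x, 0 ≤ E x := fun x => by simp only [hE]; positivity
  have hEcont : Continuous E := by fun_prop
  have h1 : ∀ x, gaussianPDF 0 v x * expKernel v (u - (x - c) ^ 2)
      = (Set.Icc (c - r) (c + r)).indicator (fun x => ENNReal.ofReal (E x)) x := by
    intro x
    rw [← setOf_sq_sub_le_eq_Icc hu c]
    by_cases hx : (x - c) ^ 2 ≤ u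
    · rw [Set.indicator_of_mem (by exact hx), expKernel, if_pos (by linarith), gaussianPDF,
        ← ENNReal.ofReal_mul (gaussianPDFReal_nonneg _ _ _), gaussianPDFReal, mul_assoc,
        ← Real.exp_add]
      congr 3
      field_simp
      ring
    · rw [Set.indicator_of_notMem (by exact hx), expKernel, if_neg (by linarith), mul_zero]
  have hcr : c - r ≤ c + r := by linarith
  have h2 : ∫⁻ x, expKernel v (u - (x - c) ^ 2) ∂(gaussianReal 0 v)
      = ENNReal.ofReal (∫ x in (c - r)..(c + r), E x) := by
    rw [gaussianReal_of_var_ne_zero _ hv, lintegral_withDensity_eq_lintegral_mul _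
      (measurable_gaussianPDF 0 v) (by fun_prop)]
    simp only [Pi.mul_apply, h1]
    rw [lintegral_indicator measurableSet_Icc, intervalIntegral.integral_of_le hcr,
      ← integral_Icc_eq_integral_Ioc, ofReal_integral_eq_lintegral_ofReal
        (hEcont.integrableOn_Icc) (Filter.Eventually.of_forall hEpos)]
  have h3 : c / v * ∫ x in (c - r)..(c + r), E x = E (c - r) - E (c + r) := by
    rw [← intervalIntegral.integral_const_mul]
    have hd : ∀ x ∈ Set.uIcc (c - r) (c + r), HasDerivAt (fun x => -E x) (c / v * E x) x := by
      intro x _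
      have h4 : HasDerivAt (fun x : ℝ => -(u + 2 * x * c - c ^ 2) / (2 * v)) (-(c / v)) x := by
        have := ((((hasDerivAt_id x).const_mul 2).mul_const c).const_add u).sub_const (c ^ 2)
        convert! (this.neg.div_const (2 * (v : ℝ))) using 1
        field_simp
      have := (h4.exp.const_mul (√(2 * Real.pi * v))⁻¹).neg
      convert! this using 1
      simp only [hE]; ring
    rw [intervalIntegral.integral_eq_sub_of_hasDerivAt hd
      ((hEcont.const_mul _).intervalIntegrable _ _)]
    ring
  have hm : E (c - r) = gaussianPDFReal 0 v (c - r) := by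
    simp only [hE, gaussianPDFReal, ← hr2]; ring_nf
  have hp : E (c + r) = gaussianPDFReal 0 v (c + r) := by
    simp only [hE, gaussianPDFReal, ← hr2]; ring_nf
  rw [h2, ← ENNReal.ofReal_mul (by positivity), h3, hm, hp]

/-- The loss of mass of an interval when its centre is shifted, as an average over noncentral
chi-square laws smoothed by an exponential law. -/
theorem gaussianReal_sq_le_eq_add {v : ℝ≥0} (hv : v ≠ 0) {b : ℝ} (hb : 0 ≤ b) (u : ℝ) :
    gaussianReal 0 v {x | (x - 0) ^ 2 ≤ u} = gaussianReal 0 v {x | (x - b) ^ 2 ≤ u}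
      + ∫⁻ c in Set.Ioc 0 b, ENNReal.ofReal (c / v) *
        ∫⁻ x, expKernel v (u - (x - c) ^ 2) ∂(gaussianReal 0 v) := by
  rcases lt_or_ge u 0 with hu | hu
  · have h1 : ∀ a : ℝ, {x : ℝ | (x - a) ^ 2 ≤ u} = ∅ := fun a =>
      Set.eq_empty_of_forall_notMem fun x hx => by
        have : (x - a) ^ 2 ≤ u := hx
        nlinarith [sq_nonneg (x - a)]
    have h2 : ∀ c x : ℝ, expKernel v (u - (x - c) ^ 2) = 0 := fun c x =>
      if_neg (by nlinarith [sq_nonneg (x - c)])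
    simp only [h1, h2]
    simp
  have hr0 : 0 ≤ √u := Real.sqrt_nonneg u
  set r := √u with hr
  set φ := gaussianPDFReal 0 v with hφ
  have hφc : Continuous φ := by
    simp only [hφ, gaussianPDFReal_def]; fun_prop
  have hφ0 : ∀ x, 0 ≤ φ x := gaussianPDFReal_nonneg 0 v
  have hmeas : ∀ a : ℝ, gaussianReal 0 v {x | (x - a) ^ 2 ≤ u}
      = ENNReal.ofReal (∫ x in (a - r)..(a + r), φ x) := by
    intro a
    rw [setOf_sq_sub_le_eq_Icc hu, gaussianReal_apply_eq_integral _ hv,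
      intervalIntegral.integral_of_le (by linarith), integral_Icc_eq_integral_Ioc]
  -- The right side is minus the derivative in `c` of the mass of `[c - r, c + r]`; its integral
  -- over `(0, b]` is the loss of mass.
  have hinner : ∀ c ∈ Set.Ioc 0 b, ENNReal.ofReal (c / v) *
        ∫⁻ x, expKernel v (u - (x - c) ^ 2) ∂(gaussianReal 0 v)
        = ENNReal.ofReal (φ (c - r) - φ (c + r)) := fun c hc =>
    lintegral_expKernel_gaussianReal hv hu hc.1.le
  have hmono : ∀ c, 0 ≤ c → 0 ≤ φ (c - r) - φ (c + r) := by
    intro c hc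
    rw [sub_nonneg]
    simp only [hφ, gaussianPDFReal]
    refine mul_le_mul_of_nonneg_left (Real.exp_le_exp.2 ?_) (by positivity)
    exact div_le_div_of_nonneg_right (by nlinarith) (by positivity)
  rw [setLIntegral_congr_fun measurableSet_Ioc hinner, ← ofReal_integral_eq_lintegral_ofReal,
    hmeas, hmeas, ← ENNReal.ofReal_add, ← intervalIntegral.integral_of_le hb]
  · congr 1
    rw [intervalIntegral.integral_sub (Continuous.intervalIntegrable (by fun_prop) _ _)
      (Continuous.intervalIntegrable (by fun_prop) _ _), intervalIntegral.integral_comp_sub_right,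
      intervalIntegral.integral_comp_add_right]
    have hii : ∀ a b, IntervalIntegrable φ volume a b := fun a b => hφc.intervalIntegrable a b
    have e1 := intervalIntegral.integral_add_adjacent_intervals (hii (0 - r) (b - r)) (hii (b - r) (b + r))
    have e2 := intervalIntegral.integral_add_adjacent_intervals (hii (0 - r) (0 + r)) (hii (0 + r) (b + r))
    linarith
  · exact intervalIntegral.integral_nonneg (by linarith) fun x _ => hφ0 x
  · exact setIntegral_nonneg measurableSet_Ioc fun c hc => hmono c hc.1.le
  · exact (Continuous.integrableOn_Icc (by fun_prop)).mono_set Set.Ioc_subset_Icc_self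
  · exact (ae_restrict_iff' measurableSet_Ioc).2
      (Filter.Eventually.of_forall fun c hc => hmono c hc.1.le)

/-- Cut the half line `Q ≤ u` into slices of width `2 v`. On slice `k` the kernel is at most
`exp(-k) ≤ 2 ^ (-k)`, each slice has probability at most `2 v K`, and the geometric series
contributes a factor `2`. -/
theorem HasConc.lintegral_expKernel_le {Ω : Type*} [MeasurableSpace Ω] {P : Measure Ω}
    {Q : Ω → ℝ} {K : ℝ} (hQ : Measurable Q) (h : HasConc P Q K) {v : ℝ≥0} (hv : v ≠ 0) (u : ℝ) :
    ∫⁻ ω, expKernel v (u - Q ω) ∂P ≤ ENNReal.ofReal (4 * v * K) := by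
  have hv' : (0 : ℝ) < v := by positivity
  set S : ℕ → Set Ω := fun k => {ω | u - (k + 1) * (2 * v) ≤ Q ω ∧
    Q ω ≤ u - (k + 1) * (2 * v) + 2 * v} with hS
  have hSm : ∀ k, MeasurableSet (S k) := fun k =>
    (measurableSet_le measurable_const hQ).inter (measurableSet_le hQ measurable_const)
  have hpt : ∀ ω, expKernel v (u - Q ω)
      ≤ ∑' k : ℕ, (S k).indicator (fun _ => (2⁻¹ : ℝ≥0∞) ^ k) ω := by
    intro ω
    rw [expKernel]
    split_ifs with hy
    swap
    · exact zero_le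
    set y := (u - Q ω) / (2 * v) with hyd
    have hy0 : 0 ≤ y := by positivity
    set k := ⌊y⌋₊ with hk
    have hk1 : (k : ℝ) ≤ y := Nat.floor_le hy0
    have hk2 : y < k + 1 := Nat.lt_floor_add_one y
    have hyeq : u - Q ω = y * (2 * v) := by rw [hyd]; field_simp
    have hmem : ω ∈ S k := by
      constructor <;> nlinarith
    refine le_trans ?_ (ENNReal.le_tsum k)
    rw [Set.indicator_of_mem hmem]
    have h2 : (2⁻¹ : ℝ≥0∞) ^ k = ENNReal.ofReal ((1 / 2) ^ k) := by
      rw [ENNReal.ofReal_pow (by norm_num), one_div, ENNReal.ofReal_inv_of_pos (by norm_num)]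
      norm_num
    rw [h2]
    refine ENNReal.ofReal_le_ofReal ?_
    calc Real.exp (-y) ≤ Real.exp (-k) := Real.exp_le_exp.2 (by linarith)
      _ = (Real.exp (-1)) ^ k := by rw [← Real.exp_nat_mul]; ring_nf
      _ ≤ (1 / 2) ^ k := by
        gcongr
        exact Real.exp_neg_one_lt_half.le
  calc ∫⁻ ω, expKernel v (u - Q ω) ∂P
      ≤ ∫⁻ ω, ∑' k : ℕ, (S k).indicator (fun _ => (2⁻¹ : ℝ≥0∞) ^ k) ω ∂P := lintegral_mono hpt
    _ = ∑' k : ℕ, (2⁻¹ : ℝ≥0∞) ^ k * P (S k) := by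
      rw [lintegral_tsum fun k => (measurable_const.indicator (hSm k)).aemeasurable]
      simp_rw [lintegral_indicator_const (hSm _)]
    _ ≤ ∑' k : ℕ, (2⁻¹ : ℝ≥0∞) ^ k * ENNReal.ofReal (K * (2 * v)) := by
      refine ENNReal.tsum_le_tsum fun k => mul_le_mul_right (h _ _ (by positivity)) _
    _ = ENNReal.ofReal (4 * v * K) := by
      rw [ENNReal.tsum_mul_right, ENNReal.tsum_geometric, ENNReal.one_sub_inv_two, inv_inv,
        ← ENNReal.ofReal_ofNat, ← ENNReal.ofReal_mul (by norm_num)]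
      congr 1; ring

theorem lintegral_comp_of_indepFun {Ω : Type*} [MeasurableSpace Ω] {P : Measure Ω}
    [IsProbabilityMeasure P] {X R : Ω → ℝ} (hX : Measurable X) (hR : Measurable R)
    (h : IndepFun X R P) {f : ℝ × ℝ → ℝ≥0∞} (hf : Measurable f) :
    ∫⁻ ω, f (X ω, R ω) ∂P = ∫⁻ r, ∫⁻ x, f (x, r) ∂(P.map X) ∂(P.map R) := by
  have : IsProbabilityMeasure (P.map X) := Measure.isProbabilityMeasure_map hX.aemeasurable
  have : IsProbabilityMeasure (P.map R) := Measure.isProbabilityMeasure_map hR.aemeasurable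
  rw [← lintegral_map (f := f) hf (hX.prodMk hR),
    (indepFun_iff_map_prod_eq_prod_map_map hX.aemeasurable hR.aemeasurable).1 h,
    lintegral_prod_symm _ hf.aemeasurable]

/-- Averaged over `R`, the loss is the integral over `c` in `(0, b]` of `c / v` times the mean of
the kernel at `u - ((X - c)² + R)`. Concentration bounds this mean by `4 v K`, so `v` cancels and
the integral of `4 K c` is `2 K b²`. The error is quadratic because the derivative vanishes at the
centred position. -/
theorem shift_coordinate_of_nonneg {Ω : Type*} [MeasurableSpace Ω] {P : Measure Ω}
    [IsProbabilityMeasure P] {X R : Ω → ℝ} (hX : Measurable X) (hR : Measurable R)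
    (hind : IndepFun X R P) {v : ℝ≥0} (hv : v ≠ 0) (hlaw : P.map X = gaussianReal 0 v) {K : ℝ}
    (hK : ∀ c, HasConc P (fun ω => (X ω - c) ^ 2 + R ω) K) {b : ℝ} (hb : 0 ≤ b) (u : ℝ) :
    P {ω | (X ω - b) ^ 2 + R ω ≤ u} ≤ P {ω | (X ω - 0) ^ 2 + R ω ≤ u} ∧
    P {ω | (X ω - 0) ^ 2 + R ω ≤ u}
      ≤ P {ω | (X ω - b) ^ 2 + R ω ≤ u} + ENNReal.ofReal (2 * K * b ^ 2) := by
  have hv' : (0 : ℝ) < v := by positivity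
  have : IsProbabilityMeasure (P.map R) := Measure.isProbabilityMeasure_map hR.aemeasurable
  have hprob : ∀ c, P {ω | (X ω - c) ^ 2 + R ω ≤ u}
      = ∫⁻ r, gaussianReal 0 v {x | (x - c) ^ 2 ≤ u - r} ∂(P.map R) := by
    intro c
    have hB : MeasurableSet {p : ℝ × ℝ | (p.1 - c) ^ 2 + p.2 ≤ u} := by measurability
    have := measure_eq_lintegral_of_indepFun hX hR hind hB
    rw [hlaw] at this
    refine Eq.trans this (lintegral_congr fun r => ?_)
    congr 1; ext x
    exact ⟨fun h => by
      have : (x - c) ^ 2 + r ≤ u := h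
      change (x - c) ^ 2 ≤ u - r; linarith, fun h => by
      have : (x - c) ^ 2 ≤ u - r := h
      change (x - c) ^ 2 + r ≤ u; linarith⟩
  set D : ℝ → ℝ≥0∞ := fun r => ∫⁻ c in Set.Ioc 0 b, ENNReal.ofReal (c / v) *
        ∫⁻ x, expKernel v (u - r - (x - c) ^ 2) ∂(gaussianReal 0 v) with hD
  have hm1 : Measurable fun p : ℝ × ℝ => ENNReal.ofReal (p.2 / v) *
      ∫⁻ x, expKernel v (u - p.1 - (x - p.2) ^ 2) ∂(gaussianReal 0 v) := by
    refine Measurable.mul (by fun_prop) ?_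
    exact Measurable.lintegral_prod_right (f := fun (q : ℝ × ℝ) (x : ℝ) =>
      expKernel v (u - q.1 - (x - q.2) ^ 2)) (by fun_prop)
  have hDm : Measurable D := Measurable.lintegral_prod_right hm1
  have hsplit : P {ω | (X ω - 0) ^ 2 + R ω ≤ u} = P {ω | (X ω - b) ^ 2 + R ω ≤ u}
      + ∫⁻ r, D r ∂(P.map R) := by
    rw [hprob, hprob, ← lintegral_add_right _ hDm]
    exact lintegral_congr fun r => gaussianReal_sq_le_eq_add hv hb (u - r)
  rw [hsplit]
  refine ⟨le_self_add, add_le_add le_rfl ?_⟩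
  have hswap : ∫⁻ r, D r ∂(P.map R) = ∫⁻ c in Set.Ioc 0 b, ENNReal.ofReal (c / v) *
      ∫⁻ ω, expKernel v (u - ((X ω - c) ^ 2 + R ω)) ∂P := by
    rw [hD, lintegral_lintegral_swap hm1.aemeasurable]
    refine lintegral_congr fun c => ?_
    have hm2 : Measurable fun r : ℝ => ∫⁻ x, expKernel v (u - r - (x - c) ^ 2)
        ∂(gaussianReal 0 v) :=
      Measurable.lintegral_prod_right (f := fun r x : ℝ =>
        expKernel v (u - r - (x - c) ^ 2)) (by fun_prop)
    rw [lintegral_const_mul _ hm2, lintegral_comp_of_indepFun hX hR hind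
      (f := fun p => expKernel v (u - ((p.1 - c) ^ 2 + p.2))) (by fun_prop), hlaw]
    congr 1
    refine lintegral_congr fun r => lintegral_congr fun x => ?_
    congr 1; ring
  rw [hswap]
  calc _ ≤ ∫⁻ c in Set.Ioc 0 b, ENNReal.ofReal (4 * K * c) := by
        refine setLIntegral_mono (by fun_prop) fun c hc => ?_
        refine (mul_le_mul_right ((hK c).lintegral_expKernel_le (by fun_prop) hv u) _).trans_eq ?_
        have hc0 : 0 ≤ c / v := div_nonneg hc.1.le hv'.le
        rw [← ENNReal.ofReal_mul hc0]
        congr 1; field_simp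
    _ ≤ ENNReal.ofReal (2 * K * b ^ 2) := by
        rcases le_total 0 K with hK0 | hK0
        · rw [← ofReal_integral_eq_lintegral_ofReal, ← intervalIntegral.integral_of_le hb,
            intervalIntegral.integral_const_mul, integral_id]
          · refine ENNReal.ofReal_le_ofReal (le_of_eq ?_)
            ring
          · exact (Continuous.integrableOn_Icc (by fun_prop)).mono_set Set.Ioc_subset_Icc_self
          · exact (ae_restrict_iff' measurableSet_Ioc).2 (Filter.Eventually.of_forall fun c hc => by
              have := hc.1.le
              change 0 ≤ 4 * K * c
              positivity)
        · rw [setLIntegral_congr_fun (g := fun _ => 0) measurableSet_Ioc fun c hc =>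
            ENNReal.ofReal_of_nonpos (by nlinarith [hc.1])]
          simp

/-- Shifting one Gaussian coordinate decreases the probability of a centered ball, by at most
a multiple of the squared shift. -/
theorem shift_coordinate {Ω : Type*} [MeasurableSpace Ω] {P : Measure Ω}
    [IsProbabilityMeasure P] {X R : Ω → ℝ} (hX : Measurable X) (hR : Measurable R)
    (hind : IndepFun X R P) {v : ℝ≥0} (hlaw : P.map X = gaussianReal 0 v) {K : ℝ}
    (hK0 : 0 ≤ K) (hK : ∀ c, HasConc P (fun ω => (X ω - c) ^ 2 + R ω) K) (b u : ℝ) :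
    P {ω | (X ω - b) ^ 2 + R ω ≤ u} ≤ P {ω | (X ω - 0) ^ 2 + R ω ≤ u} ∧
    P {ω | (X ω - 0) ^ 2 + R ω ≤ u}
      ≤ P {ω | (X ω - b) ^ 2 + R ω ≤ u} + ENNReal.ofReal (2 * K * b ^ 2) := by
  rcases eq_or_ne v 0 with rfl | hv
  · rcases eq_or_ne b 0 with rfl | hb
    · simp
    have hX0 : ∀ᵐ ω ∂P, X ω = 0 := by
      have h1 : ∀ᵐ x ∂(P.map X), x = 0 := by
        rw [hlaw, gaussianReal_zero_var, ae_dirac_eq]; simp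
      exact ae_of_ae_map hX.aemeasurable h1
    have hb2 : 0 < b ^ 2 := by positivity
    constructor
    · refine measure_mono_ae ?_
      filter_upwards [hX0] with ω h0 h1
      change (X ω - b) ^ 2 + R ω ≤ u at h1
      change (X ω - 0) ^ 2 + R ω ≤ u
      rw [h0] at h1 ⊢
      nlinarith
    -- With zero variance `X` vanishes almost surely, and the two events differ only when the
    -- unshifted quantity lies in an interval of length `b²`; concentration applies directly.
    · have hsub : P {ω | (X ω - 0) ^ 2 + R ω ≤ u} ≤ P ({ω | (X ω - b) ^ 2 + R ω ≤ u} ∪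
          {ω | u - b ^ 2 ≤ (X ω - 0) ^ 2 + R ω ∧ (X ω - 0) ^ 2 + R ω ≤ u - b ^ 2 + b ^ 2}) := by
        refine measure_mono_ae ?_
        filter_upwards [hX0] with ω h0 h1
        change (X ω - 0) ^ 2 + R ω ≤ u at h1
        by_cases h2 : (X ω - b) ^ 2 + R ω ≤ u
        · exact Or.inl h2
        · refine Or.inr ⟨?_, by linarith⟩
          rw [not_le, h0] at h2
          rw [h0]
          nlinarith
      refine hsub.trans ((measure_union_le _ _).trans (add_le_add le_rfl ?_))
      refine (hK 0 (u - b ^ 2) (b ^ 2) hb2).trans (ENNReal.ofReal_le_ofReal ?_)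
      nlinarith [mul_nonneg hK0 hb2.le]
  rcases le_total 0 b with hb | hb
  · exact shift_coordinate_of_nonneg hX hR hind hv hlaw hK hb u
  -- A negative shift of `X` is a positive shift of `-X`, which has the same law.
  · have hneg : P.map (fun ω => -X ω) = gaussianReal 0 v := by
      have h1 := gaussianReal_map_neg (μ := 0) (v := v)
      rw [← hlaw, Measure.map_map measurable_neg hX, neg_zero] at h1
      exact h1
    have hi : IndepFun (fun ω => -X ω) R P := hind.comp measurable_neg measurable_id
    have h := shift_coordinate_of_nonneg hX.neg hR hi hv hneg (K := K) (fun c => by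
      have := hK (-c)
      refine fun w ε hε => le_trans (le_of_eq ?_) (this w ε hε)
      congr 1; ext ω
      simp only [Pi.neg_apply, Set.mem_ofPred_eq]
      rw [show (-X ω - c) ^ 2 = (X ω - -c) ^ 2 by ring]) (neg_nonneg.2 hb) u
    have e1 : ∀ ω, (-X ω - -b) ^ 2 = (X ω - b) ^ 2 := fun ω => by ring
    have e2 : ∀ ω, (-X ω - 0) ^ 2 = (X ω - 0) ^ 2 := fun ω => by ring
    simpa only [Pi.neg_apply, e1, e2, neg_sq] using h

/-! ### Shifts of Gaussian vectors -/

section Shift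

variable {ι : Type*} [Fintype ι] [DecidableEq ι]

/-- Shifting a Gaussian vector decreases the probability of a centered ball, by at most a
multiple of the squared length of the shift. -/
theorem shift_gaussPi (v : ι → ℝ≥0) {K : ℝ} (hK0 : 0 ≤ K)
    (hK : ∀ a, HasConc (gaussPi v) (sqDist a) K) (a : ι → ℝ) (u : ℝ) :
    gaussPi v {x | sqDist a x ≤ u} ≤ gaussPi v {x | sqDist 0 x ≤ u} ∧
    gaussPi v {x | sqDist 0 x ≤ u}
      ≤ gaussPi v {x | sqDist a x ≤ u} + ENNReal.ofReal (2 * K * ∑ i, a i ^ 2) := by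
  -- The shift is switched on one coordinate at a time; `r J` carries it on `J` only. These
  -- intermediate centres are why concentration is required for every centre.
  set r : Finset ι → ι → ℝ := fun J => J.piecewise a 0 with hr
  suffices h : ∀ J : Finset ι,
      gaussPi v {x | sqDist (r J) x ≤ u} ≤ gaussPi v {x | sqDist 0 x ≤ u} ∧
      gaussPi v {x | sqDist 0 x ≤ u}
        ≤ gaussPi v {x | sqDist (r J) x ≤ u} + ENNReal.ofReal (2 * K * ∑ i ∈ J, a i ^ 2) by
    simpa [hr] using h Finset.univ
  intro J
  induction J using Finset.induction_on with
  | empty => simp [hr]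
  | insert j J hj ih =>
    set X : (ι → ℝ) → ℝ := fun x => x j with hX
    set R : (ι → ℝ) → ℝ := fun x => ∑ i ∈ {j}ᶜ, (x i - r J i) ^ 2 with hR
    have hRm : Measurable R := by fun_prop
    have hind : IndepFun X R (gaussPi v) := by
      have h := (iIndepFun_eval_gaussPi v).indepFun_finset {j} {j}ᶜ disjoint_compl_right
        (fun i => by fun_prop)
      exact h.comp (φ := fun p : ({j} : Finset ι) → ℝ => p ⟨j, by simp⟩)
        (ψ := fun p : (({j}ᶜ : Finset ι)) → ℝ => ∑ i, (p i - r J i) ^ 2)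
        (by fun_prop) (by fun_prop) |>.congr (Filter.EventuallyEq.refl _ _)
        (Filter.Eventually.of_forall fun x => by
          simp only [hR, Function.comp]
          exact Finset.sum_coe_sort {j}ᶜ (fun i => (x i - r J i) ^ 2))
    have hsq : ∀ c x, sqDist (Function.update (r J) j c) x = (X x - c) ^ 2 + R x := by
      intro c x
      rw [sqDist, ← Finset.sum_add_sum_compl {j}, Finset.sum_singleton, Function.update_self]
      congr 1
      refine Finset.sum_congr rfl fun i hi => ?_
      rw [Function.update_of_ne (by simpa using hi)]
    have h0 : Function.update (r J) j 0 = r J := by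
      rw [Function.update_eq_self_iff]
      simp [hr, hj]
    have h1 : r (insert j J) = Function.update (r J) j (a j) := by
      simp only [hr, Finset.piecewise_insert]
    have hs := shift_coordinate (measurable_pi_apply j) hRm hind (gaussPi_map_eval v j) hK0
      (fun c => by
        have := hK (Function.update (r J) j c)
        rwa [show sqDist (Function.update (r J) j c) = fun x => (X x - c) ^ 2 + R x from
          funext (hsq c)] at this) (a j) u
    change gaussPi v {x | (X x - a j) ^ 2 + R x ≤ u} ≤ gaussPi v {x | (X x - 0) ^ 2 + R x ≤ u} ∧
      gaussPi v {x | (X x - 0) ^ 2 + R x ≤ u} ≤ gaussPi v {x | (X x - a j) ^ 2 + R x ≤ u} + _ at hs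
    simp only [← hsq, h0, ← h1] at hs
    refine ⟨hs.1.trans ih.1, ih.2.trans ?_⟩
    rw [Finset.sum_insert hj, mul_add, ENNReal.ofReal_add (by positivity)
      (mul_nonneg (by positivity) (Finset.sum_nonneg fun i _ => sq_nonneg _)), ← add_assoc]
    exact add_le_add hs.2 le_rfl

end Shift

/-! ### Adding an independent Gaussian vector -/

section BallBounds

variable {ι : Type*} [Fintype ι] [DecidableEq ι]

theorem map_toLp_gaussPi (v : ι → ℝ≥0) :
    (gaussPi v).map (WithLp.toLp 2)
      = multivariateGaussian 0 (Matrix.diagonal fun i => (v i : ℝ)) := by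
  have : IsProbabilityMeasure ((gaussPi v).map (WithLp.toLp 2 : (ι → ℝ) → EuclideanSpace ℝ ι)) :=
    Measure.isProbabilityMeasure_map (by fun_prop)
  have hS : (Matrix.diagonal fun i => (v i : ℝ)).PosSemidef :=
    Matrix.PosSemidef.diagonal fun i => (v i).2
  refine Measure.ext_of_charFun (funext fun t => ?_)
  rw [charFun_multivariateGaussian hS, charFun_pi]
  simp_rw [charFun_gaussianReal, ← Complex.exp_sum]
  simp only [Complex.ofReal_zero, mul_zero, zero_mul, zero_sub, inner_zero_right, dotProduct,
    Matrix.mulVec_diagonal]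
  rw [Finset.sum_neg_distrib, ← Finset.sum_div]
  push_cast
  congr 3
  exact Finset.sum_congr rfl fun i _ => by ring

theorem multivariateGaussian_add {A B : Matrix ι ι ℝ} (hA : A.PosSemidef) (hB : B.PosSemidef) :
    multivariateGaussian 0 (A + B) = multivariateGaussian 0 A ∗ multivariateGaussian 0 B := by
  refine Measure.ext_of_charFun (funext fun t => ?_)
  rw [charFun_conv, charFun_multivariateGaussian hA, charFun_multivariateGaussian hB,
    charFun_multivariateGaussian (hA.add hB), ← Complex.exp_add, Matrix.add_mulVec, dotProduct_add]
  simp only [inner_zero_right]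
  push_cast
  ring_nf

theorem integral_sub_sq_gaussianReal (s : ℝ≥0) (a : ℝ) :
    Integrable (fun x => (a - x) ^ 2) (gaussianReal 0 s) ∧
      ∫ x, (a - x) ^ 2 ∂(gaussianReal 0 s) = s + a ^ 2 := by
  have h1 : Integrable (fun x : ℝ => x) (gaussianReal 0 s) :=
    (memLp_id_gaussianReal 1).integrable le_rfl
  have h2 : Integrable (fun x : ℝ => x ^ 2) (gaussianReal 0 s) :=
    (memLp_id_gaussianReal 2).integrable_sq
  have h3 : ∫ x, x ^ 2 ∂(gaussianReal 0 s) = s := by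
    have := variance_id_gaussianReal (μ := 0) (v := s)
    rwa [variance_of_integral_eq_zero (by fun_prop) (by simp)] at this
  have e : (fun x : ℝ => (a - x) ^ 2) = fun x => (x ^ 2 - 2 * a * x) + a ^ 2 := by
    ext x; ring
  rw [e]
  refine ⟨(h2.sub (h1.const_mul _)).add (integrable_const _), ?_⟩
  rw [integral_add (by exact h2.sub (h1.const_mul _)) (integrable_const _),
    integral_sub h2 (h1.const_mul _),
    integral_const_mul, h3, integral_id_gaussianReal]
  simp

theorem lintegral_sq_multivariateGaussian {S : Matrix ι ι ℝ} (hS : S.PosSemidef) {k : ℝ}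
    (hk : 0 ≤ k) (a : ι → ℝ) :
    ∫⁻ z, ENNReal.ofReal (k * ∑ i, (a i - z i) ^ 2) ∂(multivariateGaussian 0 S)
      = ENNReal.ofReal (k * (S.trace + ∑ i, a i ^ 2)) := by
  have hi : ∀ i, Integrable (fun z : EuclideanSpace ℝ ι => (a i - z i) ^ 2)
      (multivariateGaussian 0 S) ∧
      ∫ z, (a i - z i) ^ 2 ∂(multivariateGaussian 0 S) = S i i + a i ^ 2 := by
    intro i
    have hp : MeasurePreserving (fun x : EuclideanSpace ℝ ι => x i) (multivariateGaussian 0 S)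
        (gaussianReal 0 (S i i).toNNReal) :=
      measurePreserving_eval_multivariateGaussian hS
    have h := integral_sub_sq_gaussianReal (S i i).toNNReal (a i)
    rw [Real.coe_toNNReal _ hS.diag_nonneg, ← hp.map_eq] at h
    refine ⟨(integrable_map_measure (by fun_prop) hp.measurable.aemeasurable).1 h.1, ?_⟩
    rw [← h.2, integral_map hp.measurable.aemeasurable (by fun_prop)]
  rw [← ofReal_integral_eq_lintegral_ofReal
    ((integrable_finsetSum _ fun i _ => (hi i).1).const_mul k)
    (Filter.Eventually.of_forall fun z => mul_nonneg hk (Finset.sum_nonneg fun i _ => sq_nonneg _)),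
    integral_const_mul, integral_finsetSum _ fun i _ => (hi i).1]
  simp_rw [fun i => (hi i).2, Finset.sum_add_distrib]
  rfl

/-- Adding an independent centered Gaussian vector and a shift decreases the probability of a
centered ball, by at most a multiple of the trace of the covariance and of the squared shift. -/
theorem multivariateGaussian_ball_bounds (v : ι → ℝ≥0) {K : ℝ} (hK0 : 0 ≤ K)
    (hK : ∀ a, HasConc (gaussPi v) (sqDist a) K) {S : Matrix ι ι ℝ} (hS : S.PosSemidef)
    (a : ι → ℝ) (u : ℝ) :
    multivariateGaussian 0 ((Matrix.diagonal fun i => (v i : ℝ)) + S)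
        {y : EuclideanSpace ℝ ι | sqDist a y ≤ u} ≤ gaussPi v {x | sqDist 0 x ≤ u} ∧
      gaussPi v {x | sqDist 0 x ≤ u}
        ≤ multivariateGaussian 0 ((Matrix.diagonal fun i => (v i : ℝ)) + S)
          {y : EuclideanSpace ℝ ι | sqDist a y ≤ u}
          + ENNReal.ofReal (2 * K * (S.trace + ∑ i, a i ^ 2)) := by
  have hD : (Matrix.diagonal fun i => (v i : ℝ)).PosSemidef :=
    Matrix.PosSemidef.diagonal fun i => (v i).2
  have hBm : MeasurableSet {y : EuclideanSpace ℝ ι | sqDist a y ≤ u} :=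
    measurableSet_le (by fun_prop) measurable_const
  -- The law is a convolution, and for a fixed added vector `z` the centre `a` becomes `a - z`. The
  -- mean of the squared length of `a - z` is the trace of `S` plus that of `a` squared.
  have hmix : multivariateGaussian 0 ((Matrix.diagonal fun i => (v i : ℝ)) + S)
      {y : EuclideanSpace ℝ ι | sqDist a y ≤ u}
      = ∫⁻ z, gaussPi v {x | sqDist (fun i => a i - z i) x ≤ u} ∂(multivariateGaussian 0 S) := by
    rw [add_comm, multivariateGaussian_add hS hD, ← lintegral_indicator_one hBm,
      Measure.lintegral_conv (measurable_one.indicator hBm)]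
    refine lintegral_congr fun z => ?_
    rw [← map_toLp_gaussPi, lintegral_map (by
      exact (measurable_one.indicator hBm).comp (measurable_const_add z)) (by fun_prop)]
    have hset : MeasurableSet {x : ι → ℝ | sqDist (fun i => a i - z i) x ≤ u} :=
      measurableSet_le (by fun_prop) measurable_const
    rw [← lintegral_indicator_one hset]
    refine lintegral_congr fun x => ?_
    have : sqDist a (z + WithLp.toLp 2 x).ofLp = sqDist (fun i => a i - z i) x := by
      unfold sqDist
      refine Finset.sum_congr rfl fun i _ => ?_
      simp; ring
    simp only [Set.indicator, Set.mem_ofPred_eq, this, Pi.one_apply]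
  rw [hmix]
  constructor
  · refine (lintegral_mono fun z => (shift_gaussPi v hK0 hK _ u).1).trans_eq ?_
    simp
  · rw [← lintegral_sq_multivariateGaussian hS (by positivity) a,
      ← lintegral_add_right _ (by fun_prop)]
    calc gaussPi v {x | sqDist 0 x ≤ u}
        = ∫⁻ _, gaussPi v {x | sqDist 0 x ≤ u} ∂(multivariateGaussian 0 S) := by simp
      _ ≤ _ := lintegral_mono fun z => (shift_gaussPi v hK0 hK _ u).2

end BallBounds

/-! ### Rescaling -/

theorem HasConc.const_mul {Ω : Type*} [MeasurableSpace Ω] {P : Measure Ω} {Q : Ω → ℝ} {K c : ℝ}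
    (h : HasConc P Q K) (hc : 0 < c) : HasConc P (fun ω => c * Q ω) (K / c) := by
  intro w ε hε
  have := h (w / c) (ε / c) (by positivity)
  rw [show K / c * ε = K * (ε / c) by ring]
  refine le_trans (measure_mono ?_) this
  rintro ω ⟨h1, h2⟩
  refine ⟨?_, ?_⟩
  · rw [div_le_iff₀ hc]; linarith
  · rw [← add_div, le_div_iff₀ hc]; linarith

/-- Concentration of the squared distances is inherited by rescaled Gaussian vectors. -/
theorem hasConc_gaussPi_mul {ι : Type*} [Fintype ι] (v : ι → ℝ≥0) {K : ℝ}
    (hK : ∀ a, HasConc (gaussPi v) (sqDist a) K)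
    {c : ℝ≥0} (hc : 0 < c) (a : ι → ℝ) :
    HasConc (gaussPi fun i => c * v i) (sqDist a) (K / c) := by
  have hc' : (0 : ℝ) < c := hc
  set s := √(c : ℝ) with hs
  have hs0 : 0 < s := Real.sqrt_pos.2 hc'
  have hss : s ^ 2 = c := Real.sq_sqrt hc'.le
  have hlaw : (gaussPi v).map (fun x i => s * x i) = gaussPi fun i => c * v i := by
    rw [gaussPi, Measure.pi_map_pi (fun i => by fun_prop)]
    congr 1
    ext1 i
    rw [gaussianReal_map_const_mul]
    congr 1
    · simp
    · ext; simp [hss]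
  intro w ε hε
  have h := (hK fun i => s⁻¹ * a i).const_mul hc' w ε hε
  have hm : MeasurableSet {x : ι → ℝ | w ≤ sqDist a x ∧ sqDist a x ≤ w + ε} :=
    (measurableSet_le measurable_const (measurable_sqDist a)).inter
      (measurableSet_le (measurable_sqDist a) measurable_const)
  rw [← hlaw, Measure.map_apply (by fun_prop) hm]
  refine le_trans (measure_mono fun x hx => ?_) h
  have e : c * sqDist (fun i => s⁻¹ * a i) x = sqDist a fun i => s * x i := by
    rw [sqDist, sqDist, Finset.mul_sum, ← hss]
    refine Finset.sum_congr rfl fun i _ => ?_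
    field_simp
  change w ≤ sqDist a (fun i => s * x i) ∧ sqDist a (fun i => s * x i) ≤ w + ε at hx
  rw [← e] at hx
  exact hx

/-! ### Eigenvector bases of compact symmetric operators -/

section Spectral

variable {H : Type u} [NormedAddCommGroup H] [InnerProductSpace ℝ H]

/-- Orthonormal vectors are at distance `√2`, so balls of radius `1/2` around them are disjoint.
Countability is needed for continuity of measures along finite subsets of a basis. -/
theorem countable_of_orthonormal [TopologicalSpace.SeparableSpace H] {ι : Type*} {b : ι → H}
    (hb : Orthonormal ℝ b) : Countable ι := by
  refine Pairwise.countable_of_isOpen_disjoint (s := fun i => Metric.ball (b i) (1 / 2)) ?_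
    (fun i => Metric.isOpen_ball) fun i => ⟨b i, Metric.mem_ball_self (by norm_num)⟩
  intro i j hij
  refine Metric.ball_disjoint_ball ?_
  have h1 : dist (b i) (b j) ^ 2 = 2 := by
    rw [dist_eq_norm, norm_sub_sq_real, hb.1 i, hb.1 j, hb.2 hij]; norm_num
  nlinarith [dist_nonneg (x := b i) (y := b j)]

variable [CompleteSpace H]

/-- A compact symmetric operator has a Hilbert basis of eigenvectors. -/
theorem exists_hilbertBasis_eigenvectors (T : H →L[ℝ] H) (hc : IsCompactOperator T)
    (hs : T.toLinearMap.IsSymmetric) :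
    ∃ (ι : Type u) (b : HilbertBasis ι ℝ H) (μ : ι → ℝ), ∀ i, T (b i) = μ i • b i := by
  set E : ℝ → Submodule ℝ H := fun μ => Module.End.eigenspace T.toLinearMap μ with hE
  have hmem : ∀ μ x, x ∈ E μ ↔ T x = μ • x := fun μ x => Module.End.mem_eigenspace_iff
  have hcl : ∀ μ, IsClosed (E μ : Set H) := fun μ => by
    have : (E μ : Set H) = {x | T x = μ • x} := by ext x; exact hmem μ x
    rw [this]
    exact isClosed_eq T.continuous (continuous_const_smul μ)
  have hcomp : ∀ μ, CompleteSpace (E μ) := fun μ => (hcl μ).completeSpace_coe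
  have hex := fun μ => exists_hilbertBasis ℝ (E μ)
  choose w b hb using hex
  have hfam : OrthogonalFamily ℝ (fun μ => E μ) fun μ => (E μ).subtypeₗᵢ :=
    hs.orthogonalFamily_eigenspaces
  have hon : Orthonormal ℝ fun p : Σ μ, w μ => ((b p.1 p.2 : E p.1) : H) :=
    hfam.orthonormal_sigma_orthonormal fun μ => (b μ).orthonormal
  have hbot : (Submodule.span ℝ (Set.range fun p : Σ μ, w μ => ((b p.1 p.2 : E p.1) : H)))ᗮ = ⊥ := by
    rw [Submodule.eq_bot_iff]
    intro x hx
    have h1 : x ∈ (⨆ μ, E μ)ᗮ := by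
      rw [Submodule.mem_orthogonal']
      intro y hy
      -- A vector orthogonal to the chosen bases is orthogonal to each eigenspace, by expanding the
      -- elements of that eigenspace; the spectral theorem then makes it zero.
      have hle : (⨆ μ, E μ) ≤ (innerSL ℝ x).toLinearMap.ker := by
        refine iSup_le fun μ z hz => ?_
        have hsum := (b μ).hasSum_repr ⟨z, hz⟩
        have h2 := (((innerSL ℝ x).comp (E μ).subtypeL).hasSum hsum)
        have h3 : ∀ i, ((innerSL ℝ x).comp (E μ).subtypeL) ((b μ).repr ⟨z, hz⟩ i • b μ i) = 0 := by
          intro i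
          rw [map_smul]
          have : inner ℝ x ((b μ i : E μ) : H) = 0 :=
            (Submodule.mem_orthogonal' _ _).1 hx _ (Submodule.subset_span ⟨⟨μ, i⟩, rfl⟩)
          simp [this]
        have h4 := h2.unique (by simpa only [Function.comp_def, h3] using hasSum_zero)
        simpa using h4
      simpa using hle hy
    have h5 := ContinuousLinearMap.orthogonalComplement_iSup_eigenspaces_eq_bot hc hs
    exact (Submodule.eq_bot_iff _).1 h5 x h1
  refine ⟨_, HilbertBasis.mkOfOrthogonalEqBot hon hbot, fun p => p.1, fun p => ?_⟩
  rw [HilbertBasis.coe_mkOfOrthogonalEqBot]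
  exact (hmem _ _).1 (b p.1 p.2).2

end Spectral

/-! ### Covariance operators -/

section Covariance

variable {H : Type u} [NormedAddCommGroup H] [InnerProductSpace ℝ H] [CompleteSpace H]
  [TopologicalSpace.SeparableSpace H] [MeasurableSpace H] [BorelSpace H]

/-- The covariance operator is the Bochner integral of the rank-one operators `x ↦ ⟪y, x⟫ y`, and
compact operators form a closed convex set. -/
theorem isCompactOperator_covarianceOperator (μ : Measure H) [IsProbabilityMeasure μ]
    (hμ : MemLp id 2 μ) : IsCompactOperator (covarianceOperator μ) := by
  set F : H → H →L[ℝ] H := fun y => (innerSL ℝ y).smulRight y with hF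
  have hFc : Continuous F := by
    have : Continuous fun y : H => ContinuousLinearMap.smulRightL ℝ H H (innerSL ℝ y) y := by
      fun_prop
    exact this
  have hsq : Integrable (fun y : H => ‖y‖ ^ 2) μ := hμ.integrable_norm_pow two_ne_zero
  have hFi : Integrable F μ := by
    refine hsq.mono' hFc.aestronglyMeasurable (Filter.Eventually.of_forall fun y => ?_)
    rw [hF, ContinuousLinearMap.norm_smulRight_apply, innerSL_apply_norm, sq]
  have heq : covarianceOperator μ = ∫ y, F y ∂μ := by
    ext x
    rw [covarianceOperator_apply hμ, ContinuousLinearMap.integral_apply hFi]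
    refine integral_congr_ae (Filter.Eventually.of_forall fun y => ?_)
    simp [hF, real_inner_comm]
  rw [heq]
  have hconv : Convex ℝ {f : H →L[ℝ] H | IsCompactOperator f} :=
    (compactOperator (RingHom.id ℝ) H H).convex
  refine hconv.integral_mem isClosed_setOfPred_isCompactOperator
    (Filter.Eventually.of_forall fun y => ?_) hFi
  exact (isCompactOperator_of_locallyCompactSpace_rng
    (ContinuousLinearMap.toSpanSingleton ℝ y)).comp_clm (innerSL ℝ y)

theorem charFun_eq_exp_covarianceOperator (μ : Measure H) [IsGaussian μ] (h0 : ∫ x, x ∂μ = 0)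
    (t : H) : charFun μ t = Complex.exp (-(inner ℝ (covarianceOperator μ t) t / 2 : ℝ)) := by
  have h2 : MemLp id 2 μ := IsGaussian.memLp_two_id
  have hm : ∫ x, inner ℝ t x ∂μ = 0 := by
    rw [integral_inner IsGaussian.integrable_fun_id, h0, inner_zero_right]
  rw [IsGaussian.charFun_eq, integral_complex_ofReal, hm, variance_of_integral_eq_zero
    (by fun_prop) hm, covarianceOperator_inner h2]
  push_cast
  simp only [zero_mul, zero_sub, ← sq]

/-- This is Bessel's inequality, integrated. It makes the eigenvalues summable. -/
theorem sum_inner_covarianceOperator_le (μ : Measure H) (hμ : MemLp id 2 μ) {ι : Type*}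
    {b : ι → H} (hb : Orthonormal ℝ b) (s : Finset ι) :
    ∑ i ∈ s, inner ℝ (covarianceOperator μ (b i)) (b i) ≤ ∫ x, ‖x‖ ^ 2 ∂μ := by
  have hsq : Integrable (fun y : H => ‖y‖ ^ 2) μ := hμ.integrable_norm_pow two_ne_zero
  have hi : ∀ i, Integrable (fun x => inner ℝ (b i) x ^ 2) μ := fun i => by
    refine hsq.mono' (by fun_prop) (Filter.Eventually.of_forall fun x => ?_)
    rw [Real.norm_of_nonneg (sq_nonneg _)]
    have := abs_real_inner_le_norm (b i) x
    rw [hb.1 i, one_mul] at this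
    exact sq_le_sq' (by linarith [abs_le.1 this]) (abs_le.1 this).2
  simp_rw [covarianceOperator_inner hμ, ← sq]
  rw [← integral_finsetSum _ fun i _ => hi i]
  refine integral_mono (integrable_finsetSum _ fun i _ => hi i) hsq fun x => ?_
  refine le_trans (le_of_eq ?_) (hb.sum_inner_products_le x (s := s))
  simp

end Covariance

/-! ### Ordered eigenvalues and eigenvector bases -/

section Eigenvalues

variable {H : Type u} [NormedAddCommGroup H] [InnerProductSpace ℝ H] {T : H →L[ℝ] H}
  {ι : Type u} {b : HilbertBasis ι ℝ H} {μ : ι → ℝ}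

theorem ofReal_le_eigenvalue (hT : ∀ i, T (b i) = μ i • b i) {s : Finset ι} {k : ℕ}
    (hs : s.card = k + 1) {t : ℝ} (ht : ∀ i ∈ s, t ≤ μ i) :
    ENNReal.ofReal t ≤ eigenvalue T k := by
  rcases le_or_gt t 0 with h0 | h0
  · simp [ENNReal.ofReal_of_nonpos h0]
  refine le_iSup₂_of_le t ⟨h0, ?_⟩ le_rfl
  let e : Fin (k + 1) ≃ s := (s.equivFinOfCardEq hs).symm
  refine ⟨fun j => b (e j), b.orthonormal.comp _ (Subtype.val_injective.comp e.injective),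
    fun j => ⟨μ (e j), ht _ (e j).2, hT _⟩⟩

/-- A dimension count: if every `μ i` outside `F` were below `t`, eigenvectors with eigenvalue above
`t` would be orthogonal to all `b i` outside `F`. Then `k + 1` orthonormal vectors would lie in a
span of at most `k` vectors. -/
theorem exists_notMem_of_lt_eigenvalue (hs : T.toLinearMap.IsSymmetric)
    (hT : ∀ i, T (b i) = μ i • b i) {k : ℕ} {t : ℝ}
    (ht : ENNReal.ofReal t < eigenvalue T k) {F : Finset ι} (hF : F.card ≤ k) :
    ∃ i, i ∉ F ∧ t ≤ μ i := by
  classical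
  by_contra! hcon
  obtain ⟨t', ht'⟩ := lt_iSup_iff.1 ht
  obtain ⟨⟨hpos, v, hv, hev⟩, hlt⟩ := lt_iSup_iff.1 ht'
  have htt : t < t' := (ENNReal.ofReal_lt_ofReal_iff hpos).1 hlt
  have hspan : ∀ j, v j ∈ Submodule.span ℝ ((F.image b : Finset H) : Set H) := by
    intro j
    obtain ⟨ν, hν, hev⟩ := hev j
    have h1 : ∀ i, i ∉ F → b.repr (v j) i • b i = 0 := by
      intro i hi
      have h2 : inner ℝ (T (b i)) (v j) = inner ℝ (b i) (T (v j)) := hs (b i) (v j)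
      rw [hT, hev, inner_smul_left, inner_smul_right] at h2
      have h3 : (μ i - ν) * inner ℝ (b i) (v j) = 0 := by
        simp only [conj_trivial] at h2
        rw [sub_mul, h2, sub_self]
      have h4 : μ i - ν ≠ 0 := by have := hcon i hi; intro h; linarith
      rw [b.repr_apply_apply, (mul_eq_zero.1 h3).resolve_left h4, zero_smul]
    have h5 : v j = ∑ i ∈ F, b.repr (v j) i • b i :=
      (b.hasSum_repr (v j)).unique (hasSum_sum_of_ne_finset_zero fun i hi => h1 i hi)
    rw [h5]
    refine Submodule.sum_mem _ fun i hi => Submodule.smul_mem _ _ (Submodule.subset_span ?_)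
    exact_mod_cast Finset.mem_image_of_mem b hi
  have hle : Fintype.card (Fin (k + 1)) ≤ Fintype.card (F.image b) :=
    linearIndependent_le_span_aux' v hv.linearIndependent
    ((F.image b : Finset H) : Set H) (by rintro _ ⟨j, rfl⟩; exact hspan j)
  rw [Fintype.card_fin, Fintype.card_coe] at hle
  have := Finset.card_image_le (s := F) (f := b)
  omega

/-- Remove an index with the smallest value: the least of `n + 1` basis eigenvalues is at most
`eigenvalue T n`. -/
theorem sum_le_sum_eigenvalue (hT : ∀ i, T (b i) = μ i • b i) (s : Finset ι) :
    ∑ i ∈ s, ENNReal.ofReal (μ i) ≤ ∑ k ∈ Finset.range s.card, eigenvalue T k := by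
  classical
  induction hn : s.card generalizing s with
  | zero => rw [Finset.card_eq_zero.1 hn]; simp
  | succ n ih =>
    obtain ⟨j, hj, hmin⟩ := s.exists_min_image μ (Finset.card_pos.1 (by omega))
    rw [← Finset.sum_erase_add _ _ hj, Finset.sum_range_succ]
    exact add_le_add (ih _ (by rw [Finset.card_erase_of_mem hj]; omega))
      (ofReal_le_eigenvalue hT hn hmin)

theorem sum_le_trace (hT : ∀ i, T (b i) = μ i • b i) (s : Finset ι) :
    ∑ i ∈ s, ENNReal.ofReal (μ i) ≤ trace T :=
  (sum_le_sum_eigenvalue hT s).trans (ENNReal.sum_le_tsum _)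

theorem eigenvalue_ne_top (hs : T.toLinearMap.IsSymmetric) (hT : ∀ i, T (b i) = μ i • b i)
    {M : ℝ} (hM : ∀ i, μ i ≤ M) (k : ℕ) : eigenvalue T k ≠ ⊤ := by
  intro h
  have hlt : ENNReal.ofReal (|M| + 1) < eigenvalue T k := by rw [h]; exact ENNReal.ofReal_lt_top
  obtain ⟨i, -, hi⟩ := exists_notMem_of_lt_eigenvalue (k := k) hs hT hlt
    (F := ∅) (by simp)
  linarith [hM i, le_abs_self M]

/-- Greedy choice: `F` together with the indices already chosen has at most `m + n` elements, so
some further index carries at least `c` times the eigenvalue of index `m + n`. The factor `c < 1` is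
the price of a supremum not yet known to be attained; a zero eigenvalue needs no index. -/
theorem exists_finset_sum_sq_le (hs : T.toLinearMap.IsSymmetric) (hT : ∀ i, T (b i) = μ i • b i)
    (hfin : ∀ k, eigenvalue T k ≠ ⊤) {c : ℝ} (hc0 : 0 ≤ c) (hc : c < 1) {m : ℕ} {F : Finset ι}
    (hF : F.card ≤ m) (n : ℕ) :
    ∃ J : Finset ι, Disjoint F J ∧ J.card ≤ n ∧
      ∑ k ∈ Finset.range n, (c * (eigenvalue T (m + k)).toReal) ^ 2 ≤ ∑ i ∈ J, μ i ^ 2 := by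
  classical
  induction n with
  | zero => exact ⟨∅, by simp, by simp, by simp⟩
  | succ n ih =>
    obtain ⟨J, hd, hcard, hsum⟩ := ih
    rw [Finset.sum_range_succ]
    set l := (eigenvalue T (m + n)).toReal with hl
    rcases (ENNReal.toReal_nonneg : 0 ≤ l).eq_or_lt with h0 | h0
    · refine ⟨J, hd, by omega, ?_⟩
      rw [show l = 0 from h0.symm]; simpa using hsum
    · have hlt : ENNReal.ofReal (c * l) < eigenvalue T (m + n) := by
        rw [← ENNReal.ofReal_toReal (hfin (m + n)), ENNReal.ofReal_lt_ofReal_iff h0]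
        nlinarith
      obtain ⟨i, hi, hle⟩ := exists_notMem_of_lt_eigenvalue hs hT hlt
        (F := F ∪ J) ((Finset.card_union_le _ _).trans (by omega))
      rw [Finset.mem_union, not_or] at hi
      refine ⟨insert i J, ?_, ?_, ?_⟩
      · rw [Finset.disjoint_insert_right]; exact ⟨hi.1, hd⟩
      · rw [Finset.card_insert_of_notMem hi.2]; omega
      · rw [Finset.sum_insert hi.2, add_comm]
        have : (c * l) ^ 2 ≤ μ i ^ 2 := pow_le_pow_left₀ (by positivity) hle 2
        linarith

/-- The square of `tailNorm`, as a real number. -/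
def tailSq (T : H →L[ℝ] H) (m : ℕ) : ℝ := ∑' k, (eigenvalue T (m + k)).toReal ^ 2

/-- The greedy choice with factor `1/2` bounds the partial sums by four times a sum of squares `μ i
^ 2`, and such a sum is at most `M * M`. -/
theorem summable_sq_eigenvalue (hs : T.toLinearMap.IsSymmetric) (hT : ∀ i, T (b i) = μ i • b i)
    (h0 : ∀ i, 0 ≤ μ i) {M : ℝ} (hM : ∀ s : Finset ι, ∑ i ∈ s, μ i ≤ M) (m : ℕ) :
    Summable fun k => (eigenvalue T (m + k)).toReal ^ 2 := by
  have hM1 : ∀ i, μ i ≤ M := fun i => by simpa using hM {i}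
  have hM0 : 0 ≤ M := by simpa using hM ∅
  have hfin := eigenvalue_ne_top hs hT hM1
  refine summable_of_sum_range_le (c := 4 * (M * M)) (fun k => sq_nonneg _) fun n => ?_
  obtain ⟨J, -, -, h⟩ := exists_finset_sum_sq_le hs hT hfin (c := 1 / 2) (by norm_num)
    (by norm_num) (m := m) (F := ∅) (by simp) n
  simp_rw [mul_pow, ← Finset.mul_sum] at h
  have h1 : ∑ i ∈ J, μ i ^ 2 ≤ M * M := by
    calc ∑ i ∈ J, μ i ^ 2 ≤ ∑ i ∈ J, M * μ i := Finset.sum_le_sum fun i _ => by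
          rw [sq]; exact mul_le_mul_of_nonneg_right (hM1 i) (h0 i)
      _ = M * ∑ i ∈ J, μ i := by rw [Finset.mul_sum]
      _ ≤ M * M := mul_le_mul_of_nonneg_left (hM J) hM0
  linarith

theorem tailNorm_eq (hfin : ∀ k, eigenvalue T k ≠ ⊤)
    {m : ℕ} (hsum : Summable fun k => (eigenvalue T (m + k)).toReal ^ 2) :
    tailNorm T m = ENNReal.ofReal √(tailSq T m) := by
  have h1 : ∑' j, eigenvalue T (m + j) ^ 2 = ENNReal.ofReal (tailSq T m) := by
    rw [tailSq, ENNReal.ofReal_tsum_of_nonneg (fun k => sq_nonneg _) hsum]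
    refine tsum_congr fun j => ?_
    rw [ENNReal.ofReal_pow ENNReal.toReal_nonneg, ENNReal.ofReal_toReal (hfin _)]
  rw [tailNorm, h1, Real.sqrt_eq_rpow, ENNReal.ofReal_rpow_of_nonneg
    (show 0 ≤ tailSq T m from tsum_nonneg fun k => sq_nonneg _) (by norm_num)]

theorem exists_finset_tailSq_le (hs : T.toLinearMap.IsSymmetric) (hT : ∀ i, T (b i) = μ i • b i)
    (hfin : ∀ k, eigenvalue T k ≠ ⊤) {m : ℕ}
    (hsum : Summable fun k => (eigenvalue T (m + k)).toReal ^ 2) (hpos : 0 < tailSq T m)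
    {F : Finset ι} (hF : F.card ≤ m) :
    ∃ J : Finset ι, Disjoint F J ∧ (9 / 10) * tailSq T m ≤ ∑ i ∈ J, μ i ^ 2 := by
  -- Truncating the series keeps `95/100` of the tail and the greedy choice loses a factor
  -- `(98/100)²`; the product still exceeds `9/10`.
  have hlt : (95 / 100) * tailSq T m < tailSq T m := by linarith
  obtain ⟨n, hn⟩ := ((hsum.hasSum.tendsto_sum_nat).eventually (lt_mem_nhds hlt)).exists
  obtain ⟨J, hd, -, hJ⟩ := exists_finset_sum_sq_le hs hT hfin (c := 98 / 100) (by norm_num)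
    (by norm_num) hF n
  refine ⟨J, hd, le_trans ?_ hJ⟩
  simp_rw [mul_pow, ← Finset.mul_sum]
  linarith

end Eigenvalues

/-! ### The factor `ϰ` as a concentration constant -/

section Kappa

variable {H : Type u} [NormedAddCommGroup H] [InnerProductSpace ℝ H] {T : H →L[ℝ] H}

theorem eigenvalue_le_tailNorm (T : H →L[ℝ] H) (m k : ℕ) :
    eigenvalue T (m + k) ≤ tailNorm T m := by
  have h : eigenvalue T (m + k) ^ 2 ≤ ∑' j, eigenvalue T (m + j) ^ 2 :=
    ENNReal.le_tsum (f := fun j => eigenvalue T (m + j) ^ 2) k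
  have h2 := ENNReal.rpow_le_rpow h (show (0 : ℝ) ≤ 1 / 2 by norm_num)
  rwa [← ENNReal.rpow_natCast, ← ENNReal.rpow_mul, show ((2 : ℕ) : ℝ) * (1 / 2) = 1 by norm_num,
    ENNReal.rpow_one] at h2

theorem tailNorm_one_le (T : H →L[ℝ] H) : tailNorm T 1 ≤ tailNorm T 0 := by
  refine ENNReal.rpow_le_rpow ?_ (by norm_num)
  simp_rw [add_comm 1, zero_add]
  exact ENNReal.tsum_comp_le_tsum_of_injective (add_left_injective 1) fun j => eigenvalue T j ^ 2

theorem tailNorm_zero_le_trace (T : H →L[ℝ] H) : tailNorm T 0 ≤ trace T := by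
  have h : ∑' j, eigenvalue T (0 + j) ^ 2 ≤ trace T ^ 2 := by
    simp_rw [zero_add, sq]
    calc ∑' j, eigenvalue T j * eigenvalue T j ≤ ∑' j, eigenvalue T j * trace T :=
          ENNReal.tsum_le_tsum fun j => mul_le_mul_right (ENNReal.le_tsum j) _
      _ = trace T * trace T := by rw [ENNReal.tsum_mul_right]; rfl
  have h2 := ENNReal.rpow_le_rpow h (show (0 : ℝ) ≤ 1 / 2 by norm_num)
  rwa [← ENNReal.rpow_natCast (trace T), ← ENNReal.rpow_mul,
    show ((2 : ℕ) : ℝ) * (1 / 2) = 1 by norm_num, ENNReal.rpow_one] at h2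

theorem inv_le_mul_rpow {x y z : ℝ≥0∞} (hx : x ≤ z) (hy : y ≤ z) :
    z⁻¹ ≤ (x * y) ^ (-1 / 2 : ℝ) := by
  have h1 : (x * y) ^ (1 / 2 : ℝ) ≤ z := by
    have h2 := ENNReal.rpow_le_rpow (mul_le_mul' hx hy) (show (0 : ℝ) ≤ 1 / 2 by norm_num)
    rwa [← sq, ← ENNReal.rpow_natCast z, ← ENNReal.rpow_mul,
      show ((2 : ℕ) : ℝ) * (1 / 2) = 1 by norm_num, ENNReal.rpow_one] at h2
  rw [show (-1 / 2 : ℝ) = -(1 / 2) by norm_num, ENNReal.rpow_neg]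
  exact ENNReal.inv_le_inv.2 h1

/-- The numbers `λ₁`, `λ₂` and `Λ₂` are all at most `Λ₁`, so each branch of `ϰ` is at least `1/Λ₁`.
-/
theorem inv_tailNorm_le_kappa (T : H →L[ℝ] H) : (tailNorm T 0)⁻¹ ≤ kappa T := by
  have h0 : eigenvalue T 0 ≤ tailNorm T 0 := eigenvalue_le_tailNorm T 0 0
  have h1 : eigenvalue T 1 ≤ tailNorm T 0 := by simpa using eigenvalue_le_tailNorm T 0 1
  unfold kappa
  split_ifs
  · exact le_rfl
  · exact inv_le_mul_rpow h0 (tailNorm_one_le T)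
  · exact inv_le_mul_rpow h0 h1

/-- Since `Λ₁` is at most the trace, `ϰ` times the trace cannot be small. This settles the
comparison when the covariances are not relatively close. -/
theorem one_le_kappa_mul_trace (h0 : eigenvalue T 0 ≠ 0) (ht : tailNorm T 0 ≠ ⊤) :
    1 ≤ kappa T * trace T := by
  have hne : tailNorm T 0 ≠ 0 := fun h => h0 (le_antisymm (h ▸ eigenvalue_le_tailNorm T 0 0) zero_le)
  rw [← ENNReal.inv_mul_cancel hne ht]
  exact mul_le_mul' (inv_tailNorm_le_kappa T) (tailNorm_zero_le_trace T)

theorem ofReal_rpow_ne_top {x : ℝ} (h : ENNReal.ofReal x ^ (-1 / 2 : ℝ) ≠ ⊤) :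
    0 < x ∧ (ENNReal.ofReal x ^ (-1 / 2 : ℝ)).toReal = (√x)⁻¹ := by
  have hx : 0 < x := by
    by_contra hcon
    rw [ENNReal.ofReal_of_nonpos (not_lt.1 hcon), ENNReal.zero_rpow_of_neg (by norm_num)] at h
    exact h rfl
  refine ⟨hx, ?_⟩
  rw [ENNReal.ofReal_rpow_of_pos hx, ENNReal.toReal_ofReal (by positivity),
    show (-1 / 2 : ℝ) = -(1 / 2) by norm_num, Real.rpow_neg hx.le, ← Real.sqrt_eq_rpow]

/-- The absolute constant in the concentration bound. -/
def concConst : ℝ := (∫ s, profile s) + (∫ s, singularProfile s) + 1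

theorem integral_profile_nonneg : 0 ≤ ∫ s, profile s := integral_nonneg profile_nonneg

theorem concConst_pos : 0 < concConst := by
  have := integral_profile_nonneg
  have := integral_singularProfile_nonneg
  unfold concConst; linarith

theorem HasConc.mono {Ω : Type*} [MeasurableSpace Ω] {P : Measure Ω} {Q : Ω → ℝ} {K K' : ℝ}
    (h : HasConc P Q K) (hK : K ≤ K') : HasConc P Q K' := fun w ε hε =>
  (h w ε hε).trans (ENNReal.ofReal_le_ofReal (mul_le_mul_of_nonneg_right hK hε.le))

variable {ι : Type u} {b : HilbertBasis ι ℝ H} {μ : ι → ℝ}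

/-- The squared distance of a finite-dimensional projection of a Gaussian element to a point has
concentration of order `kappa`, if the projection keeps enough eigenvectors. -/
theorem exists_finset_hasConc_kappa (hs : T.toLinearMap.IsSymmetric)
    (hT : ∀ i, T (b i) = μ i • b i) (h0 : ∀ i, 0 ≤ μ i) {M : ℝ}
    (hM : ∀ s : Finset ι, ∑ i ∈ s, μ i ≤ M) (hκ : kappa T ≠ ⊤) :
    ∃ J : Finset ι, ∀ s : Finset ι, J ⊆ s → ∀ a : s → ℝ,
      HasConc (gaussPi fun i : s => (μ i).toNNReal) (sqDist a) (concConst * (kappa T).toReal) := by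
  classical
  have hM1 : ∀ i, μ i ≤ M := fun i => by simpa using hM {i}
  have hfin := eigenvalue_ne_top hs hT hM1
  have hsum := summable_sq_eigenvalue hs hT h0 hM
  have hI1 := integral_profile_nonneg
  have hI2 := integral_singularProfile_nonneg
  set l : ℕ → ℝ := fun k => (eigenvalue T k).toReal with hl
  have hl0 : ∀ k, 0 ≤ l k := fun k => ENNReal.toReal_nonneg
  have hle : ∀ k, eigenvalue T k = ENNReal.ofReal (l k) := fun k =>
    (ENNReal.ofReal_toReal (hfin k)).symm
  have htail : ∀ m, tailNorm T m = ENNReal.ofReal √(tailSq T m) := fun m =>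
    tailNorm_eq hfin (hsum m)
  have htail0 : ∀ m, 0 ≤ tailSq T m := fun m => tsum_nonneg fun k => sq_nonneg _
  have hcond : ∀ m, 3 * eigenvalue T m ^ 2 ≤ tailNorm T m ^ 2 ↔ 3 * l m ^ 2 ≤ tailSq T m := by
    intro m
    rw [hle, htail, ← ENNReal.ofReal_pow (hl0 m), ← ENNReal.ofReal_pow (Real.sqrt_nonneg _),
      Real.sq_sqrt (htail0 m), show (3 : ℝ≥0∞) = ENNReal.ofReal 3 by simp,
      ← ENNReal.ofReal_mul (by norm_num), ENNReal.ofReal_le_ofReal_iff (htail0 m)]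
  have hμl : ∀ i, μ i ≤ l 0 := fun i => by
    have := ofReal_le_eigenvalue (k := 0) hT (s := {i}) (t := μ i) (by simp) (by simp)
    rwa [hle, ENNReal.ofReal_le_ofReal_iff (hl0 0)] at this
  have hcoe : ∀ i, ((μ i).toNNReal : ℝ) = μ i := fun i => Real.coe_toNNReal _ (h0 i)
  have hsub : ∀ {J s : Finset ι}, J ⊆ s →
      ∑ i ∈ J.subtype (· ∈ s), ((μ i).toNNReal : ℝ) ^ 2 = ∑ i ∈ J, μ i ^ 2 := fun {J s} hJs => by
    simp_rw [hcoe]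
    exact Finset.sum_subtype_of_mem (fun i => μ i ^ 2) fun i hi => hJs hi
  unfold kappa at hκ ⊢
  simp only [hcond] at hκ ⊢
  by_cases hc1 : 3 * l 0 ^ 2 ≤ tailSq T 0
  · rw [if_pos hc1] at hκ ⊢
    rw [htail] at hκ ⊢
    have hpos : 0 < √(tailSq T 0) := by
      rw [ne_eq, ENNReal.inv_eq_top, ENNReal.ofReal_eq_zero, not_le] at hκ
      exact hκ
    have hpos' : 0 < tailSq T 0 := Real.sqrt_pos.1 hpos
    obtain ⟨J, -, hJ⟩ := exists_finset_tailSq_le hs hT hfin (hsum 0) hpos' (F := ∅) (by simp)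
    refine ⟨J, fun s hJs a => ?_⟩
    -- With `m` a third of the squared tail, `5/2 * m` is `5/6` of it, less than the `9/10` retained
    -- by `J`.
    refine (hasConc_sqDist_of_spread (fun i : s => (μ i).toNNReal) (J.subtype (· ∈ s))
      (m := tailSq T 0 / 3) (by positivity) (fun i _ => ?_) ?_ a).mono ?_
    · rw [hcoe]
      have := pow_le_pow_left₀ (h0 i) (hμl i) 2
      linarith
    · rw [hsub hJs]; linarith
    · rw [ENNReal.toReal_inv, ENNReal.toReal_ofReal hpos.le, mul_comm]
      refine mul_le_mul (by unfold concConst; linarith) ?_ (by positivity) concConst_pos.le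
      refine inv_anti₀ hpos ?_
      rw [← Real.sqrt_sq (show (0 : ℝ) ≤ 2 by norm_num), ← Real.sqrt_mul (by positivity)]
      exact Real.sqrt_le_sqrt (by linarith)
  rw [if_neg hc1] at hκ ⊢
  have hl0pos : 0 < l 0 := by
    refine lt_of_le_of_ne (hl0 0) fun h => hc1 ?_
    rw [← h]; simpa using htail0 0
  -- The largest eigenvalue is a supremum, so an index is taken whose value is within two percent of
  -- it.
  obtain ⟨i₀, -, hi₀⟩ := exists_notMem_of_lt_eigenvalue (k := 0) (t := 98 / 100 * l 0) hs hT
    (by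
      rw [hle, ENNReal.ofReal_lt_ofReal_iff hl0pos]; linarith) (F := ∅) (by simp)
  have hi₀pos : 0 < μ i₀ := lt_of_lt_of_le (by positivity) hi₀
  by_cases hc2 : 3 * l 1 ^ 2 ≤ tailSq T 1
  · rw [if_pos hc2] at hκ ⊢
    rw [hle, htail, ← ENNReal.ofReal_mul (hl0 0)] at hκ ⊢
    obtain ⟨hpos, heq⟩ := ofReal_rpow_ne_top hκ
    have hposS : 0 < √(tailSq T 1) := pos_of_mul_pos_right hpos hl0pos.le
    have hpos' : 0 < tailSq T 1 := Real.sqrt_pos.1 hposS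
    obtain ⟨J, hd, hJ⟩ := exists_finset_tailSq_le hs hT hfin (hsum 1) hpos' (F := {i₀}) (by simp)
    rw [Finset.disjoint_singleton_left] at hd
    refine ⟨insert i₀ J, fun s hJs a => ?_⟩
    have hi₀s : i₀ ∈ s := hJs (Finset.mem_insert_self _ _)
    have hJs' : J ⊆ s := fun i hi => hJs (Finset.mem_insert_of_mem hi)
    -- Outside `i₀` the values are at most `λ₂ / (98/100)`, so their squares are at most this `m`.
    -- Its multiple by `5/2` is still below `9/10` of the squared tail.
    have hm : 0 < tailSq T 1 / (3 * (98 / 100) ^ 2) := by positivity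
    refine (hasConc_sqDist_of_dominant (fun i : s => (μ i).toNNReal) (J.subtype (· ∈ s))
      hm (fun i hi => ?_) ?_ (i₀ := ⟨i₀, hi₀s⟩)
      (by simpa using hd) (by simpa using hi₀pos) a).mono ?_
    · have hne : (i : ι) ≠ i₀ := fun h => hd (h ▸ Finset.mem_subtype.1 hi)
      rw [hcoe]
      -- Both `i₀` and `i` carry eigenvalues of at least `98/100 * μ i`, so the second largest
      -- eigenvalue is at least that.
      have hmin : 98 / 100 * μ i ≤ l 1 := by
        have := ofReal_le_eigenvalue (k := 1) hT (s := {i₀, (i : ι)}) (t := 98 / 100 * μ i)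
          (Finset.card_pair hne.symm) (by
            intro j hj
            rw [Finset.mem_insert, Finset.mem_singleton] at hj
            rcases hj with rfl | rfl
            · linarith [hμl i]
            · linarith [h0 i])
        rwa [hle, ENNReal.ofReal_le_ofReal_iff (hl0 1)] at this
      have h3 := pow_le_pow_left₀ (mul_nonneg (by norm_num) (h0 i)) hmin 2
      rw [mul_pow] at h3
      rw [le_div_iff₀ (by norm_num)]
      linarith
    · rw [hsub hJs']
      refine le_trans ?_ hJ
      rw [← mul_div_assoc, div_le_iff₀ (by norm_num)]
      linarith
    · rw [heq, mul_comm]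
      refine mul_le_mul (by unfold concConst; linarith) ?_ (by positivity) concConst_pos.le
      refine inv_anti₀ (Real.sqrt_pos.2 hpos) ?_
      rw [hcoe, ← Real.sqrt_sq (show (0 : ℝ) ≤ 2 by norm_num), ← Real.sqrt_mul (by positivity)]
      refine Real.sqrt_le_sqrt ?_
      have h4 : √(tailSq T 1) / 2 ≤ √(tailSq T 1 / (3 * (98 / 100) ^ 2)) := by
        rw [div_le_iff₀ (by norm_num), mul_comm, ← Real.sqrt_sq (show (0 : ℝ) ≤ 2 by norm_num),
          ← Real.sqrt_mul (by positivity)]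
        refine Real.sqrt_le_sqrt ?_
        rw [← mul_div_assoc, le_div_iff₀ (by norm_num)]
        linarith
      have h5 : l 0 / 2 * (√(tailSq T 1) / 2)
          ≤ μ i₀ * √(tailSq T 1 / (3 * (98 / 100) ^ 2)) :=
        mul_le_mul (by linarith) h4 (by positivity) hi₀pos.le
      linarith
  · rw [if_neg hc2] at hκ ⊢
    rw [hle, hle, ← ENNReal.ofReal_mul (hl0 0)] at hκ ⊢
    obtain ⟨hpos, heq⟩ := ofReal_rpow_ne_top hκ
    have hl1pos : 0 < l 1 := pos_of_mul_pos_right hpos hl0pos.le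
    obtain ⟨i₁, hi₁, hi₁l⟩ := exists_notMem_of_lt_eigenvalue (k := 1) (t := 98 / 100 * l 1) hs hT
      (by rw [hle, ENNReal.ofReal_lt_ofReal_iff hl1pos]; linarith)
      (F := {i₀}) (by simp)
    rw [Finset.mem_singleton] at hi₁
    have hi₁pos : 0 < μ i₁ := lt_of_lt_of_le (by positivity) hi₁l
    refine ⟨{i₀, i₁}, fun s hJs a => ?_⟩
    have hi₀s : i₀ ∈ s := hJs (by simp)
    have hi₁s : i₁ ∈ s := hJs (by simp)
    refine (hasConc_sqDist_of_pair (fun i : s => (μ i).toNNReal) (i₀ := ⟨i₀, hi₀s⟩)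
      (i₁ := ⟨i₁, hi₁s⟩) (by simpa using Ne.symm hi₁) (by simpa using hi₀pos)
      (by simpa using hi₁pos) a).mono ?_
    -- The planar bound involves no integral; the summand `1` in `concConst` covers it.
    rw [heq, ← one_mul (2 * _)⁻¹]
    refine mul_le_mul (by unfold concConst; linarith) ?_ (by positivity) concConst_pos.le
    refine inv_anti₀ (Real.sqrt_pos.2 hpos) ?_
    rw [hcoe, hcoe, ← Real.sqrt_sq (show (0 : ℝ) ≤ 2 by norm_num), ← Real.sqrt_mul (by positivity)]
    refine Real.sqrt_le_sqrt ?_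
    have h5 : l 0 / 2 * (l 1 / 2) ≤ μ i₀ * μ i₁ :=
      mul_le_mul (by linarith) (by linarith) (by positivity) hi₀pos.le
    linarith

end Kappa

/-! ### The whitened norm and quadratic forms -/

section Whitened

variable {H : Type*} [NormedAddCommGroup H] [InnerProductSpace ℝ H] [CompleteSpace H]

theorem sqrtOp_spec {T : H →L[ℝ] H} (hT : T.IsPositive) :
    (sqrtOp T).IsPositive ∧ sqrtOp T ∘L sqrtOp T = T := by
  rw [sqrtOp, dif_pos hT]
  exact (exists_sqrt T hT).choose_spec

/-- If the whitened operator norm is finite, it controls the relative difference of the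
quadratic forms. -/
theorem abs_inner_sub_le_whitenedNorm {T R : H →L[ℝ] H} (hT : T.IsPositive)
    (hR : R.toLinearMap.IsSymmetric) (hδ : whitenedNorm T R ≠ ⊤) (z : H) :
    |inner ℝ (R z) z - inner ℝ (T z) z| ≤ (whitenedNorm T R).toReal * inner ℝ (T z) z := by
  obtain ⟨hSpos, hSS⟩ := sqrtOp_spec hT
  set δ := whitenedNorm T R with hδd
  set S := sqrtOp T with hS
  have hSsym : ∀ x y, inner ℝ (S x) y = inner ℝ x (S y) := hSpos.isSymmetric
  have hRsym : ∀ x y, inner ℝ (R x) y = inner ℝ x (R y) := hR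
  have hTS : ∀ x, inner ℝ (T x) x = inner ℝ (S x) (S x) := fun x => by
    rw [← hSS, ContinuousLinearMap.comp_apply, hSsym]
  set N := S.toLinearMap.ker with hN
  have hNmem : ∀ x, x ∈ N ↔ S x = 0 := fun x => Iff.rfl
  have hNc : CompleteSpace N := S.isClosed_ker.completeSpace_coe
  set f : H →ₗ.[ℝ] H := S.toLinearMap.toPMap Nᗮ with hf
  have hinv : invSqrtOp T = f.inverse := rfl
  have hfker : f.toFun.ker = ⊥ := by
    rw [Submodule.eq_bot_iff]
    rintro ⟨x, hx⟩ h
    have h1 : S x = 0 := h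
    have : x = 0 := by
      have h2 := (Submodule.mem_orthogonal _ _).1 hx x ((hNmem x).2 h1)
      exact inner_self_eq_zero.1 h2
    exact Subtype.ext this
  have hdom : ∀ y, y ∈ f.inverse.domain ↔ ∃ x : Nᗮ, S x = y := by
    intro y
    rw [LinearPMap.inverse_domain]
    exact Iff.rfl
  by_cases h : ∀ y, R y ∈ (invSqrtOp T).domain
  swap
  · exact absurd (by rw [hδd, whitenedNorm, dif_neg h]) hδ
  -- The range of `R` lies in the range of `S`, hence is orthogonal to `ker S`. By symmetry `⟪R x, R
  -- x⟫ = ⟪x, R (R x)⟫ = 0` for `x` in the kernel.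
  have hR0 : ∀ x ∈ N, R x = 0 := by
    intro x hx
    obtain ⟨w, hw⟩ := (hdom _).1 (h (R x))
    have h1 : inner ℝ (R x) (R x) = 0 := by
      rw [hRsym, ← hw, ← hSsym, (hNmem x).1 hx, inner_zero_left]
    exact inner_self_eq_zero.1 h1
  -- Test the norm at the unit vector `S z`. Its preimage under `S` in the orthogonal complement of
  -- the kernel is the component `z₁` of `z`; if `S w = R z₁`, the difference of the forms is `⟪w -
  -- S z, S z⟫`. The general case follows by homogeneity.
  have hunit : ∀ z, ‖S z‖ = 1 → |inner ℝ (R z) z - inner ℝ (S z) (S z)| ≤ δ.toReal := by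
    intro z hz
    obtain ⟨z₀, hz₀, z₁, hz₁, rfl⟩ := N.exists_add_mem_mem_orthogonal z
    have hSz : S (z₀ + z₁) = S z₁ := by rw [map_add, (hNmem z₀).1 hz₀, zero_add]
    rw [hSz] at hz ⊢
    have hmem : S z₁ ∈ (invSqrtOp T).domain := (hdom _).2 ⟨⟨z₁, hz₁⟩, rfl⟩
    have hx : invSqrtOp T ⟨S z₁, hmem⟩ = z₁ :=
      LinearPMap.inverse_apply_eq hfker (y := ⟨S z₁, hmem⟩) (x := ⟨z₁, hz₁⟩) rfl
    obtain ⟨w, hw⟩ := (hdom _).1 (h z₁)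
    have hy : ∀ hm, invSqrtOp T ⟨R z₁, hm⟩ = w := fun hm =>
      LinearPMap.inverse_apply_eq hfker (y := ⟨R z₁, hm⟩) (x := w) hw
    have hle : ‖(w : H) - S z₁‖ₑ ≤ δ := by
      rw [hδd, whitenedNorm, dif_pos h]
      refine le_iSup₂_of_le ⟨S z₁, hmem⟩ hz ?_
      simp only [hx, hy]
      exact le_rfl
    have hle' : ‖(w : H) - S z₁‖ ≤ δ.toReal := by
      rw [← toReal_enorm]
      exact ENNReal.toReal_mono hδ hle
    have e1 : inner ℝ (R (z₀ + z₁)) (z₀ + z₁) = inner ℝ (w : H) (S z₁) := by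
      rw [map_add, hR0 z₀ hz₀, zero_add, inner_add_right, hRsym z₁ z₀, hR0 z₀ hz₀,
        inner_zero_right, zero_add, ← hw, hSsym]
    rw [e1, ← inner_sub_left]
    refine (abs_real_inner_le_norm _ _).trans ?_
    rw [hz, mul_one]
    exact hle'
  rw [hTS]
  rcases eq_or_ne (S z) 0 with h0 | h0
  · rw [h0, inner_zero_left, hR0 z ((hNmem z).2 h0), inner_zero_left]
    simp
  · have hn : ‖S z‖ ≠ 0 := norm_ne_zero_iff.2 h0
    have h1 := hunit (‖S z‖⁻¹ • z) (by
      rw [map_smul, norm_smul, norm_inv, norm_norm, inv_mul_cancel₀ hn])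
    simp only [map_smul, inner_smul_left, inner_smul_right, conj_trivial] at h1
    rw [real_inner_self_eq_norm_sq] at h1 ⊢
    rw [← mul_sub, ← mul_sub, abs_mul, abs_mul, abs_of_nonneg (by positivity)] at h1
    have h2 := mul_le_mul_of_nonneg_left h1 (sq_nonneg ‖S z‖)
    rw [mul_comm δ.toReal]
    refine le_trans (le_of_eq ?_) h2
    field_simp

end Whitened

/-! ### Finite-dimensional projections -/

section Projection

variable {H : Type u} [NormedAddCommGroup H] [InnerProductSpace ℝ H]
  {ι : Type u} (b : HilbertBasis ι ℝ H) (s : Finset ι)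

/-- The matrix of the quadratic form of `A` on finitely many basis vectors. -/
def gram (A : H →L[ℝ] H) : Matrix s s ℝ := Matrix.of fun i j => inner ℝ (A (b i)) (b j)

theorem dotProduct_gram_mulVec (A : H →L[ℝ] H) (t : s → ℝ) :
    t ⬝ᵥ (gram b s A).mulVec t
      = inner ℝ (A (∑ i, t i • b i)) (∑ i, t i • b i) := by
  simp only [dotProduct, Matrix.mulVec, gram, Matrix.of_apply, map_sum, map_smul, sum_inner,
    inner_sum, inner_smul_left, inner_smul_right, conj_trivial, Finset.mul_sum]
  rw [Finset.sum_comm]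
  exact Finset.sum_congr rfl fun i _ => Finset.sum_congr rfl fun j _ => by ring

theorem posSemidef_gram {A : H →L[ℝ] H} (hA : A.toLinearMap.IsSymmetric)
    (hpos : ∀ x, 0 ≤ inner ℝ (A x) x) : (gram b s A).PosSemidef := by
  refine Matrix.PosSemidef.of_dotProduct_mulVec_nonneg ?_ fun t => ?_
  · ext i j
    simp only [Matrix.conjTranspose_apply, gram, Matrix.of_apply, star_trivial]
    rw [real_inner_comm]
    exact (hA (b i) (b j)).symm
  · rw [star_trivial, dotProduct_gram_mulVec]
    exact hpos _

theorem trace_gram (A : H →L[ℝ] H) :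
    (gram b s A).trace = ∑ i ∈ s, inner ℝ (A (b i)) (b i) := by
  rw [Matrix.trace]
  exact Finset.sum_coe_sort s fun i => inner ℝ (A (b i)) (b i)

theorem gram_eq_diagonal [DecidableEq ι] {A : H →L[ℝ] H} {μ : ι → ℝ}
    (hA : ∀ i, A (b i) = μ i • b i) : gram b s A = Matrix.diagonal fun i : s => μ i := by
  ext i j
  rw [gram, Matrix.of_apply, hA, inner_smul_left, conj_trivial, Matrix.diagonal_apply,
    orthonormal_iff_ite.1 b.orthonormal]
  by_cases h : i = j
  · rw [if_pos (congrArg _ h), if_pos h, mul_one]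
  · rw [if_neg (Subtype.coe_injective.ne h), if_neg h, mul_zero]

/-- The coordinates of a vector on finitely many basis vectors. -/
def coords (x : H) : EuclideanSpace ℝ s := WithLp.toLp 2 fun i : s => inner ℝ (b i) x

variable [CompleteSpace H] [TopologicalSpace.SeparableSpace H] [MeasurableSpace H] [BorelSpace H]

theorem measurable_coords : Measurable (coords b s) := by
  unfold coords; fun_prop

/-- The characteristic function of the coordinates at `t` is that of `ν` at `∑ i, t i • b i`, and
the covariance form at this vector is the form of the Gram matrix at `t`. -/
theorem map_coords [DecidableEq ι] (ν : Measure H) [IsGaussian ν] (h0 : ∫ x, x ∂ν = 0) :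
    ν.map (coords b s) = multivariateGaussian 0 (gram b s (covarianceOperator ν)) := by
  have hp : (covarianceOperator ν).toLinearMap.IsPositive := isPositive_covarianceOperator
  have hS := posSemidef_gram b s hp.1 hp.2
  have : IsProbabilityMeasure (ν.map (coords b s)) :=
    Measure.isProbabilityMeasure_map (measurable_coords b s).aemeasurable
  refine Measure.ext_of_charFun (funext fun t => ?_)
  rw [charFun_multivariateGaussian hS, charFun_apply,
    integral_map (measurable_coords b s).aemeasurable (by fun_prop)]
  have h1 : ∀ x, inner ℝ (coords b s x) t = inner ℝ x (∑ i, t i • b i) := by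
    intro x
    simp only [coords, PiLp.inner_apply, inner_sum, inner_smul_right]
    exact Finset.sum_congr rfl fun i _ => by simp [real_inner_comm]
  simp_rw [h1]
  rw [← charFun_apply, charFun_eq_exp_covarianceOperator ν h0, dotProduct_gram_mulVec]
  simp only [inner_zero_right]
  push_cast
  ring_nf

end Projection

/-! ### Passage to the limit over finite sets of coordinates -/

section Limit

variable {H : Type u} [NormedAddCommGroup H] [InnerProductSpace ℝ H]
  {ι : Type u} (b : HilbertBasis ι ℝ H)

theorem sqDist_coords (s : Finset ι) (a x : H) :
    sqDist (fun i : s => inner ℝ (b i) a) (coords b s x).ofLp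
      = ∑ i ∈ s, inner ℝ (b i) (x - a) ^ 2 := by
  rw [sqDist, ← Finset.sum_coe_sort s]
  exact Finset.sum_congr rfl fun i _ => by simp [coords, inner_sub_right]

theorem hasSum_inner_sq (x : H) : HasSum (fun i => inner ℝ (b i) x ^ 2) (‖x‖ ^ 2) := by
  have := b.hasSum_inner_mul_inner x x
  rw [real_inner_self_eq_norm_sq] at this
  refine this.congr_fun fun i => ?_
  rw [sq, real_inner_comm x]

variable [CompleteSpace H] [TopologicalSpace.SeparableSpace H] [MeasurableSpace H] [BorelSpace H]

/-- By Parseval the closed ball is the decreasing intersection of the cylinders obtained from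
finitely many coordinates; continuity from above applies. -/
theorem tendsto_map_coords_ball [Countable ι] (ν : Measure H) [IsProbabilityMeasure ν] (a : H)
    (u : ℝ) :
    Filter.Tendsto (fun s : Finset ι => ν.map (coords b s)
      {y : EuclideanSpace ℝ s | sqDist (fun i : s => inner ℝ (b i) a) y ≤ u}) Filter.atTop
      (nhds (ν {x | ‖x - a‖ ^ 2 ≤ u})) := by
  have h1 : ∀ s : Finset ι, ν.map (coords b s)
      {y : EuclideanSpace ℝ s | sqDist (fun i : s => inner ℝ (b i) a) y ≤ u}
      = ν {x | ∑ i ∈ s, inner ℝ (b i) (x - a) ^ 2 ≤ u} := by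
    intro s
    rw [Measure.map_apply (measurable_coords b s)
      (measurableSet_le (by fun_prop) measurable_const)]
    congr 1
    ext x
    simp only [Set.mem_preimage, Set.mem_ofPred_eq, sqDist_coords]
  have h2 : {x | ‖x - a‖ ^ 2 ≤ u}
      = ⋂ s : Finset ι, {x | ∑ i ∈ s, inner ℝ (b i) (x - a) ^ 2 ≤ u} := by
    ext x
    simp only [Set.mem_iInter, Set.mem_ofPred_eq]
    constructor
    · intro h s
      exact (sum_le_hasSum s (fun i _ => sq_nonneg _) (hasSum_inner_sq b (x - a))).trans h
    · intro h
      exact le_of_tendsto' (hasSum_inner_sq b (x - a)) h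
  simp_rw [h1]
  rw [h2]
  refine tendsto_measure_iInter_atTop (fun s => ?_) ?_ ⟨∅, measure_ne_top _ _⟩
  · exact (measurableSet_le (by fun_prop) measurable_const).nullMeasurableSet
  · intro s t hst x (hx : ∑ i ∈ t, inner ℝ (b i) (x - a) ^ 2 ≤ u)
    change ∑ i ∈ s, inner ℝ (b i) (x - a) ^ 2 ≤ u
    exact (Finset.sum_le_sum_of_subset_of_nonneg hst fun i _ _ => sq_nonneg _).trans hx

end Limit

theorem ofReal_tsum_le_trace {H : Type u} [NormedAddCommGroup H] [InnerProductSpace ℝ H]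
    {ι : Type u} {b : HilbertBasis ι ℝ H} {T : H →L[ℝ] H} {μ : ι → ℝ}
    (hT : ∀ i, T (b i) = μ i • b i) (h0 : ∀ i, 0 ≤ μ i)
    (hsum : Summable μ) : ENNReal.ofReal (∑' i, μ i) ≤ trace T := by
  rw [ENNReal.ofReal_tsum_of_nonneg h0 hsum, ENNReal.tsum_eq_iSup_sum]
  exact iSup_le fun s => sum_le_trace hT s

/-! ### Comparison of ball probabilities -/

section Comparison

variable {H : Type u} [NormedAddCommGroup H] [InnerProductSpace ℝ H] [CompleteSpace H]
  [TopologicalSpace.SeparableSpace H] [MeasurableSpace H] [BorelSpace H]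
  {ι : Type u} {b : HilbertBasis ι ℝ H} {T : H →L[ℝ] H} {μ : ι → ℝ}

/-- A centered Gaussian measure whose covariance operator dominates `c • T` gives a projected ball
almost the same measure as the Gaussian vector with covariance `c • T`. -/
theorem map_coords_ball_bounds (hs : T.toLinearMap.IsSymmetric) (hT : ∀ i, T (b i) = μ i • b i)
    (h0 : ∀ i, 0 ≤ μ i) (ρ : Measure H) [IsGaussian ρ] (hρ : ∫ x, x ∂ρ = 0) {c : ℝ≥0}
    (hc : ∀ z, c * inner ℝ (T z) z ≤ inner ℝ (covarianceOperator ρ z) z) (s : Finset ι) {K m : ℝ}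
    (hK0 : 0 ≤ K)
    (hK : ∀ a, HasConc (gaussPi fun i : s => c * (μ i).toNNReal) (sqDist a) K)
    (hm : ∑ i ∈ s, (inner ℝ (covarianceOperator ρ (b i)) (b i) - c * μ i) ≤ m) (a : H) (u : ℝ) :
    ρ.map (coords b s) {y : EuclideanSpace ℝ s | sqDist (fun i : s => inner ℝ (b i) a) y ≤ u}
        ≤ gaussPi (fun i : s => c * (μ i).toNNReal) {x | sqDist 0 x ≤ u} ∧
      gaussPi (fun i : s => c * (μ i).toNNReal) {x | sqDist 0 x ≤ u}
        ≤ ρ.map (coords b s)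
          {y : EuclideanSpace ℝ s | sqDist (fun i : s => inner ℝ (b i) a) y ≤ u}
          + ENNReal.ofReal (2 * K * (m + ‖a‖ ^ 2)) := by
  classical
  set R := covarianceOperator ρ with hR
  have hp : R.toLinearMap.IsPositive := isPositive_covarianceOperator
  have hsub : (R - (c : ℝ) • T).toLinearMap.IsSymmetric := by
    intro x y
    have h1 : inner ℝ (R x) y = inner ℝ x (R y) := hp.1 x y
    have h2 : inner ℝ (T x) y = inner ℝ x (T y) := hs x y
    simp [inner_sub_left, inner_sub_right, inner_smul_left, inner_smul_right, h1, h2]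
  have hS : (gram b s (R - (c : ℝ) • T)).PosSemidef := by
    refine posSemidef_gram b s hsub fun x => ?_
    simpa [inner_sub_left, inner_smul_left] using hc x
  -- The covariance of the coordinates splits into the diagonal part coming from `c • T` and a
  -- positive semidefinite remainder.
  have hgram : gram b s R = (Matrix.diagonal fun i : s => ((c * (μ i).toNNReal : ℝ≥0) : ℝ))
      + gram b s (R - (c : ℝ) • T) := by
    have h1 : (Matrix.diagonal fun i : s => ((c * (μ i).toNNReal : ℝ≥0) : ℝ))
        = gram b s ((c : ℝ) • T) := by
      rw [gram_eq_diagonal (μ := fun i => c * μ i) b s fun i => by simp [hT, smul_smul]]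
      simp [Real.coe_toNNReal _ (h0 _)]
    rw [h1]
    ext i j
    simp [gram, inner_sub_left]
  have htr : (gram b s (R - (c : ℝ) • T)).trace ≤ m := by
    rw [trace_gram]
    refine le_trans (Finset.sum_le_sum fun i _ => le_of_eq ?_) hm
    simp [inner_sub_left, inner_smul_left, hT, b.orthonormal.1 i]
  have ha : ∑ i : s, inner ℝ (b i) a ^ 2 ≤ ‖a‖ ^ 2 := by
    rw [Finset.sum_coe_sort s fun i => inner ℝ (b i) a ^ 2]
    exact sum_le_hasSum s (fun i _ => sq_nonneg _) (hasSum_inner_sq b a)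
  rw [map_coords b s ρ hρ, ← hR, hgram]
  obtain ⟨h1, h2⟩ := multivariateGaussian_ball_bounds _ hK0 hK hS (fun i : s => inner ℝ (b i) a) u
  refine ⟨h1, h2.trans ?_⟩
  gcongr

/-- If the covariance operators are relatively close, so are the measures of the balls. -/
theorem measure_ball_le_add (ν ρ : Measure H) [IsGaussian ν] [IsGaussian ρ]
    (hν : ∫ x, x ∂ν = 0) (hρ : ∫ x, x ∂ρ = 0)
    (hT : ∀ i, covarianceOperator ν (b i) = μ i • b i) (h0 : ∀ i, 0 ≤ μ i) {M : ℝ}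
    (hM : ∀ s : Finset ι, ∑ i ∈ s, μ i ≤ M) (hκ : kappa (covarianceOperator ν) ≠ ⊤) {δ : ℝ}
    (hδ0 : 0 ≤ δ) (hδ : δ < 1 / 2)
    (hR : ∀ z, |inner ℝ (covarianceOperator ρ z) z - inner ℝ (covarianceOperator ν z) z|
      ≤ δ * inner ℝ (covarianceOperator ν z) z) (a : H) (u : ℝ) :
    ν {x | ‖x - a‖ ^ 2 ≤ u} ≤ ρ {x | ‖x‖ ^ 2 ≤ u} + ENNReal.ofReal
        (8 * concConst * (kappa (covarianceOperator ν)).toReal * (M * δ + ‖a‖ ^ 2)) ∧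
      ρ {x | ‖x‖ ^ 2 ≤ u} ≤ ν {x | ‖x - a‖ ^ 2 ≤ u} + ENNReal.ofReal
        (8 * concConst * (kappa (covarianceOperator ν)).toReal * (M * δ + ‖a‖ ^ 2)) := by
  classical
  have hcount : Countable ι := countable_of_orthonormal b.orthonormal
  set T := covarianceOperator ν with hTd
  have hp : T.toLinearMap.IsPositive := isPositive_covarianceOperator
  have hTb : ∀ i, inner ℝ (T (b i)) (b i) = μ i := fun i => by
    simp [hT, inner_smul_left, b.orthonormal.1 i]
  set κ := (kappa T).toReal with hκd
  have hκ0 : 0 ≤ κ := ENNReal.toReal_nonneg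
  have hC := concConst_pos
  obtain ⟨J, hJ⟩ := exists_finset_hasConc_kappa hp.1 hT h0 hM hκ
  -- Both `T` and `R` dominate `(1 - δ) T`, and `c ≥ 1/2` costs at most a factor `2` in the
  -- concentration constant.
  obtain ⟨c, hcδ⟩ : ∃ c : ℝ≥0, (c : ℝ) = 1 - δ := ⟨⟨1 - δ, by linarith⟩, rfl⟩
  have hc2 : (1 / 2 : ℝ) ≤ c := by linarith
  have hc0 : 0 < c := NNReal.coe_pos.1 (by linarith)
  have hM0 : 0 ≤ M := by simpa using hM ∅
  have hK0 : 0 ≤ concConst * κ / c := by positivity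
  have hK2 : concConst * κ / c ≤ 2 * (concConst * κ) := by
    rw [div_le_iff₀ (by linarith)]
    nlinarith [mul_nonneg hC.le hκ0]
  have hnn : ∀ z, 0 ≤ inner ℝ (T z) z := hp.2
  have hEle : ∀ a : H, 2 * (concConst * κ / c) * (2 * δ * M + ‖a‖ ^ 2)
      ≤ 8 * concConst * κ * (M * δ + ‖a‖ ^ 2) := by
    intro a
    calc 2 * (concConst * κ / c) * (2 * δ * M + ‖a‖ ^ 2)
        ≤ 2 * (2 * (concConst * κ)) * (2 * (M * δ + ‖a‖ ^ 2)) := by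
          gcongr
          nlinarith [sq_nonneg ‖a‖]
      _ = _ := by ring
  have hE0 : 8 * concConst * κ * (M * δ + ‖(0 : H)‖ ^ 2)
      ≤ 8 * concConst * κ * (M * δ + ‖a‖ ^ 2) := by
    gcongr
    simp
  set E := ENNReal.ofReal (8 * concConst * κ * (M * δ + ‖a‖ ^ 2)) with hE
  -- On the basis, the remainders `T - c T = δ T` and `R - c T` are both at most `2 δ μ i`. The
  -- constant `8` is the product of `2` from the shift inequality, `2` from rescaling and `2` from
  -- this trace bound.
  have hsumδ : ∀ s : Finset ι, ∑ i ∈ s, 2 * δ * μ i ≤ 2 * δ * M := fun s => by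
    rw [← Finset.mul_sum]
    exact mul_le_mul_of_nonneg_left (hM s) (by linarith)
  -- Both projected ball probabilities are compared with the same Gaussian vector of variances `c μ
  -- i`: each is at most its centred ball probability, which exceeds the other by at most the error.
  have key : ∀ s, J ≤ s →
      (ν.map (coords b s) {y : EuclideanSpace ℝ s | sqDist (fun i : s => inner ℝ (b i) a) y ≤ u}
        ≤ ρ.map (coords b s)
          {y : EuclideanSpace ℝ s | sqDist (fun i : s => inner ℝ (b i) (0 : H)) y ≤ u} + E) ∧
      ρ.map (coords b s)
          {y : EuclideanSpace ℝ s | sqDist (fun i : s => inner ℝ (b i) (0 : H)) y ≤ u}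
        ≤ ν.map (coords b s)
          {y : EuclideanSpace ℝ s | sqDist (fun i : s => inner ℝ (b i) a) y ≤ u} + E := by
    intro s hsJ
    have hK := hasConc_gaussPi_mul (fun i : s => (μ i).toNNReal) (hJ s hsJ) hc0
    obtain ⟨h1, h2⟩ := map_coords_ball_bounds hp.1 hT h0 ν hν (c := c)
      (fun z => by rw [hcδ]; nlinarith [hnn z]) s hK0 hK (m := 2 * δ * M)
      ((Finset.sum_le_sum fun i _ => by rw [hTb, hcδ]; nlinarith [h0 i]).trans (hsumδ s)) a u
    obtain ⟨h3, h4⟩ := map_coords_ball_bounds hp.1 hT h0 ρ hρ (c := c)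
      (fun z => by rw [hcδ]; nlinarith [abs_le.1 (hR z)]) s hK0 hK (m := 2 * δ * M)
      ((Finset.sum_le_sum fun i _ => by
        have := (abs_le.1 (hR (b i))).2
        rw [hTb] at this
        rw [hcδ]; linarith).trans (hsumδ s)) 0 u
    refine ⟨h1.trans (h4.trans ?_), h3.trans (h2.trans ?_)⟩
    · gcongr
      exact ENNReal.ofReal_le_ofReal ((hEle 0).trans hE0)
    · gcongr
      exact ENNReal.ofReal_le_ofReal (hEle a)
  have l1 := tendsto_map_coords_ball b ν a u
  have l2 := tendsto_map_coords_ball b ρ 0 u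
  simp only [sub_zero] at l2
  constructor
  · exact le_of_tendsto_of_tendsto l1 (l2.add tendsto_const_nhds)
      (Filter.eventually_atTop.2 ⟨J, fun s hs => (key s hs).1⟩)
  · exact le_of_tendsto_of_tendsto l2 (l1.add tendsto_const_nhds)
      (Filter.eventually_atTop.2 ⟨J, fun s hs => (key s hs).2⟩)

theorem eq_of_inner_covarianceOperator_eq (ν ρ : Measure H) [IsGaussian ν] [IsGaussian ρ]
    (hν : ∫ x, x ∂ν = 0) (hρ : ∫ x, x ∂ρ = 0)
    (h : ∀ z, inner ℝ (covarianceOperator ρ z) z = inner ℝ (covarianceOperator ν z) z) :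
    ν = ρ :=
  Measure.ext_of_charFun <| funext fun t => by
    rw [charFun_eq_exp_covarianceOperator ν hν, charFun_eq_exp_covarianceOperator ρ hρ, h]

theorem ofReal_abs_measureReal_sub_le {Ω : Type*} [MeasurableSpace Ω] {P Q : Measure Ω}
    [IsFiniteMeasure P] [IsFiniteMeasure Q] {A B : Set Ω} {E : ℝ≥0∞} (h1 : P A ≤ Q B + E)
    (h2 : Q B ≤ P A + E) : ENNReal.ofReal |P.real A - Q.real B| ≤ E := by
  rcases eq_or_ne E ⊤ with rfl | hE
  · exact le_top
  refine ENNReal.ofReal_le_of_le_toReal (abs_le.2 ⟨?_, ?_⟩)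
  · have := ENNReal.toReal_mono (by finiteness) h2
    rw [ENNReal.toReal_add (by finiteness) hE] at this
    simp only [Measure.real]; linarith
  · have := ENNReal.toReal_mono (by finiteness) h1
    rw [ENNReal.toReal_add (by finiteness) hE] at this
    simp only [Measure.real]; linarith

/-- The comparison of ball probabilities for centered Gaussian measures. -/
theorem ofReal_abs_ball_sub_le (ν ρ : Measure H) [IsGaussian ν] [IsGaussian ρ]
    (hν : ∫ x, x ∂ν = 0) (hρ : ∫ x, x ∂ρ = 0) (hne : covarianceOperator ν ≠ 0) (a : H) (u : ℝ) :
    ENNReal.ofReal |ν.real {x | ‖x - a‖ ^ 2 ≤ u} - ρ.real {x | ‖x‖ ^ 2 ≤ u}|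
      ≤ ENNReal.ofReal (8 * concConst + 2) * kappa (covarianceOperator ν)
        * (trace (covarianceOperator ν)
            * whitenedNorm (covarianceOperator ν) (covarianceOperator ρ)
          + ENNReal.ofReal (‖a‖ ^ 2)) := by
  have hp : (covarianceOperator ν).toLinearMap.IsPositive := isPositive_covarianceOperator
  have hpR : (covarianceOperator ρ).toLinearMap.IsPositive := isPositive_covarianceOperator
  have hν2 : MemLp id 2 ν := IsGaussian.memLp_two_id
  obtain ⟨ι, b, μ, hT⟩ := exists_hilbertBasis_eigenvectors _
    (isCompactOperator_covarianceOperator ν hν2) hp.1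
  have hTb : ∀ i, inner ℝ (covarianceOperator ν (b i)) (b i) = μ i := fun i => by
    simp [hT, inner_smul_left, b.orthonormal.1 i]
  have h0 : ∀ i, 0 ≤ μ i := fun i => by rw [← hTb]; exact hp.2 _
  have hM : ∀ s : Finset ι, ∑ i ∈ s, μ i ≤ ∫ x, ‖x‖ ^ 2 ∂ν := fun s => by
    simpa only [hTb] using sum_inner_covarianceOperator_le ν hν2 b.orthonormal s
  have hsum : Summable μ := summable_of_sum_le h0 hM
  have htrace := ofReal_tsum_le_trace hT h0 hsum
  have hev0 : eigenvalue (covarianceOperator ν) 0 ≠ 0 := by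
    obtain ⟨i, hi⟩ : ∃ i, μ i ≠ 0 := by
      by_contra! h
      refine hne (ContinuousLinearMap.ext_on
        (Submodule.dense_iff_topologicalClosure_eq_top.2 b.dense_span) ?_)
      rintro _ ⟨i, rfl⟩
      simp [hT, h]
    have := ofReal_le_eigenvalue hT (s := {i}) (k := 0) (t := μ i) (by simp) (by simp)
    refine (lt_of_lt_of_le ?_ this).ne'
    exact ENNReal.ofReal_pos.2 ((h0 i).lt_of_ne' hi)
  have htail : tailNorm (covarianceOperator ν) 0 ≠ ⊤ := by
    rw [tailNorm_eq (eigenvalue_ne_top hp.1 hT fun i => by simpa using hM {i})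
      (summable_sq_eigenvalue hp.1 hT h0 hM 0)]
    exact ENNReal.ofReal_ne_top
  have hone := one_le_kappa_mul_trace hev0 htail
  have hC := concConst_pos
  -- The summand `2` in the constant serves the regime `δ ≥ 1/2`, where `2 * 1 * 2⁻¹ = 1` is to be
  -- matched.
  have hC2 : (2 : ℝ≥0∞) ≤ ENNReal.ofReal (8 * concConst + 2) := by
    rw [← ENNReal.ofReal_ofNat]
    exact ENNReal.ofReal_le_ofReal (by linarith)
  set T := covarianceOperator ν with hTd
  set R := covarianceOperator ρ with hRd
  set δ := whitenedNorm T R with hδd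
  have hTpos : T.IsPositive := hp
  by_cases hδ : δ < 2⁻¹
  · have hδt : δ ≠ ⊤ := (hδ.trans_le le_top).ne
    have hquad := abs_inner_sub_le_whitenedNorm hTpos hpR.1 hδt
    by_cases hκ : kappa T = ⊤
    -- With `ϰ = ∞` the right side is infinite unless the bracket vanishes, where `∞ * 0 = 0`. In
    -- that case `a = 0` and `δ = 0`, so the two laws coincide and the left side is zero too.
    · by_cases hbr : trace T * δ + ENNReal.ofReal (‖a‖ ^ 2) = 0
      · obtain ⟨hb1, hb2⟩ := add_eq_zero.1 hbr
        have htr0 : trace T ≠ 0 := fun h => by simp [h] at hone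
        have hδ0 : δ = 0 := (mul_eq_zero.1 hb1).resolve_left htr0
        have ha : a = 0 := by
          have := ENNReal.ofReal_eq_zero.1 hb2
          simpa using le_antisymm this (sq_nonneg _)
        have heq : ν = ρ := eq_of_inner_covarianceOperator_eq ν ρ hν hρ fun z => by
          have := hquad z
          rw [← hδd, hδ0, ENNReal.toReal_zero, zero_mul] at this
          exact sub_eq_zero.1 (abs_nonpos_iff.1 this)
        simp [ha, ← heq]
      · rw [hκ, ENNReal.mul_top (by positivity), ENNReal.top_mul hbr]
        exact le_top
    · have hδr : δ.toReal < 1 / 2 := by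
        have := (ENNReal.toReal_lt_toReal hδt (by simp)).2 hδ
        simpa using this
      obtain ⟨h1, h2⟩ := measure_ball_le_add ν ρ hν hρ hT h0 (M := ∑' i, μ i)
        (fun s => hsum.sum_le_tsum s fun i _ => h0 i) hκ ENNReal.toReal_nonneg hδr hquad a u
      refine (ofReal_abs_measureReal_sub_le h1 h2).trans ?_
      have hS0 : 0 ≤ ∑' i, μ i := tsum_nonneg h0
      rw [ENNReal.ofReal_mul (by positivity), ENNReal.ofReal_mul (by positivity),
        ENNReal.ofReal_toReal hκ, ENNReal.ofReal_add (by positivity) (by positivity),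
        ENNReal.ofReal_mul hS0, ENNReal.ofReal_toReal hδt]
      gcongr
      linarith
  · have hL : ENNReal.ofReal |ν.real {x | ‖x - a‖ ^ 2 ≤ u} - ρ.real {x | ‖x‖ ^ 2 ≤ u}| ≤ 1 :=
      ofReal_abs_measureReal_sub_le (prob_le_one.trans le_add_self) (prob_le_one.trans le_add_self)
    refine hL.trans ?_
    calc (1 : ℝ≥0∞) = 2 * 1 * 2⁻¹ := by
          rw [mul_one, ENNReal.mul_inv_cancel two_ne_zero ENNReal.ofNat_ne_top]
      _ ≤ ENNReal.ofReal (8 * concConst + 2) * (kappa T * trace T) * δ := by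
          gcongr
          exact not_lt.1 hδ
      _ = ENNReal.ofReal (8 * concConst + 2) * kappa T * (trace T * δ) := by ring
      _ ≤ _ := by
          gcongr
          exact le_self_add

end Comparison

end GaussianComparison

end

theorem mainTheorem6 :
    ∃ C : ℝ≥0, 0 < C ∧
      ∀ (Ω : Type*) (_ : MeasurableSpace Ω) (P : Measure Ω) (_ : IsProbabilityMeasure P)
        (H : Type*) (_ : NormedAddCommGroup H) (_ : InnerProductSpace ℝ H)
        (_ : CompleteSpace H) (_ : TopologicalSpace.SeparableSpace H)
        (_ : MeasurableSpace H) (_ : BorelSpace H)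
        (ξ η : Ω → H),
        HasGaussianLaw ξ P → HasGaussianLaw η P →
        ∫ ω, ξ ω ∂P = 0 → ∫ ω, η ω ∂P = 0 →
        GaussianComparison.cov P ξ ≠ 0 →
        ∀ a : H,
          (⨆ (x : ℝ) (_ : 0 < x),
              ENNReal.ofReal |P.real {ω | ‖ξ ω - a‖ ≤ x} - P.real {ω | ‖η ω‖ ≤ x}|)
            ≤ C * (GaussianComparison.kappa (GaussianComparison.cov P ξ)
                    + GaussianComparison.kappa (GaussianComparison.cov P η))
                * (GaussianComparison.trace (GaussianComparison.cov P ξ)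
                      * GaussianComparison.whitenedNorm
                          (GaussianComparison.cov P ξ) (GaussianComparison.cov P η)
                    + ENNReal.ofReal (‖a‖ ^ 2)) := by
  have hC := GaussianComparison.concConst_pos
  refine ⟨(8 * GaussianComparison.concConst + 2).toNNReal, Real.toNNReal_pos.2 (by linarith), ?_⟩
  intro Ω _ P _ H _ _ _ _ _ _ ξ η hξ hη hξ0 hη0 hne a
  refine iSup₂_le fun x hx => ?_
  have hξm := hξ.aemeasurable
  have hηm := hη.aemeasurable
  have := hξ.isGaussian_map
  have := hη.isGaussian_map
  have hball : ∀ z : H, ‖z‖ ≤ x ↔ ‖z‖ ^ 2 ≤ x ^ 2 := fun z =>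
    (sq_le_sq₀ (norm_nonneg z) hx.le).symm
  have h1 : P.real {ω | ‖ξ ω - a‖ ≤ x} = (P.map ξ).real {y | ‖y - a‖ ^ 2 ≤ x ^ 2} := by
    rw [map_measureReal_apply_of_aemeasurable hξm
      (measurableSet_le (by fun_prop) measurable_const)]
    simp only [hball, Set.preimage_ofPred_eq]
  have h2 : P.real {ω | ‖η ω‖ ≤ x} = (P.map η).real {y | ‖y‖ ^ 2 ≤ x ^ 2} := by
    rw [map_measureReal_apply_of_aemeasurable hηm
      (measurableSet_le (by fun_prop) measurable_const)]
    simp only [hball, Set.preimage_ofPred_eq]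
  rw [h1, h2]
  refine (GaussianComparison.ofReal_abs_ball_sub_le (P.map ξ) (P.map η)
    (by rw [integral_map hξm (by fun_prop)]; exact hξ0)
    (by rw [integral_map hηm (by fun_prop)]; exact hη0) hne a (x ^ 2)).trans ?_
  rw [ENNReal.ofReal]
  gcongr
  -- The estimate with `ϰ(Σ_ξ)` alone already holds; the summand `ϰ(Σ_η)` only enlarges the right
  -- side.
  exact le_self_add
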